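/- Let $1\le p<\infty$ and let $\rho:\mathbb R\to(0,\infty)$ be an admissible weight function, i.e. $\rho$ is (Lebesgue) measurable and there exist constants $M\ge 1$ and $\omega\in\mathbb R$ such that $\rho(\tau)\le M e^{\omega t}\rho(\tau+t)$ for all $\tau\in\mathbb R$ and all $t>0$. Let $$L_p^\rho(\mathbb R)=\Bigl\{u:\mathbb R\to\mathbb R \text{ measurable} : \|u\|=\Bigl(\int_{\mathbb R}|u(t)|^p\rho(t)\,dt\Bigr)^{1/p}<\infty\Bigr\}$$ (functions equal almost everywhere being identified), and let $\mathcal T=(T_t)_{t\ge0}$, $T_tf(x)=f(x+t)$, be the translation $C_0$-semigroup on $L_p^\rho(\mathbb R)$. The following assertions are equivalent: 1. $\mathcal T$ is frequently hypercyclic on $L_p^\rho(\mathbb R)$; 2. $\sum_{k\in\mathbb Z}\rho(k)<\infty$; 3. $\int_{-\infty}^{\infty}\rho(t)\,dt<\infty$; 4. $\mathcal T$ is chaotic on $L_p^\rho(\mathbb R)$; 5. $\mathcal T$ satisfies the Frequent Hypercyclicity Criterion. Here, for a $C_0$-semigroup $(T_t)_{t\ge 0}$ of continuous linear operators on a separable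 Banach space $X$: - it is *frequently hypercyclic* if there is $x\in X$ such that, for every non-empty open $U\subseteq X$, the set $A=\{t\ge0: T_tx\in U\}$ has positive lower density, i.e. $\liminf_{N\to\infty}\mu(A\cap[0,N])/N>0$, where $\mu$ is Lebesgue measure; - it is *chaotic* if there is $x\in X$ whose orbit $\{T_tx:t\ge0\}$ is dense in $X$, and the set of periodic points $\{x\in X:\exists\, t>0,\ T_tx=x\}$ is dense in $X$; - it *satisfies the Frequent Hypercyclicity Criterion* if there exist a dense subset $X_0\subseteq X$ and maps $S_t:X_0\to X_0$, $t>0$, such that for every $x\in X_0$: (i) $T_tS_tx=x$ for all $t>0$ and $T_tS_rx=S_{r-t}x$ for all $r>t>0$; (ii) $t\mapsto T_tx$ is Pettis integrable on $[0,\infty)$; (iii) $t\mapsto S_tx$ is Pettis integrable on $[0,\infty)$. A function $f:[0,\infty)\to X$ is *Pettis integrable* if $\varphi\circ f$ is Lebesgue integrable for every $\varphi\in X^*$ and for every measurable $E\subseteq[0,\infty)$ there is $x_E\in X$ with $\varphi(x_E)=\int_E\varphi(f(t))\,dt$ for all $\varphi\in X^*$. -/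

import Mathlib

open MeasureTheory Filter Topology Set
open scoped NNReal ENNReal

/-- A `C₀`-semigroup (strongly continuous one-parameter semigroup) of continuous linear operators
on a real normed space `X`. -/
structure C0Semigroup (X : Type*) [NormedAddCommGroup X] [NormedSpace ℝ X] where
  /-- the operator `T_t` -/
  op : ℝ≥0 → X →L[ℝ] X
  op_zero : op 0 = ContinuousLinearMap.id ℝ X
  op_add : ∀ s t : ℝ≥0, op (s + t) = (op s).comp (op t)
  tendsto_zero : ∀ x : X, Tendsto (fun t : ℝ≥0 => op t x) (𝓝 0) (𝓝 x)

/-- The lower density `liminf_{N → ∞} μ(A ∩ [0, N]) / N` of a set `A ⊆ [0, ∞)`, where `μ` is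
Lebesgue measure. -/
noncomputable def lowerDensity (A : Set ℝ) : ℝ≥0∞ :=
  liminf (fun N : ℝ => volume (A ∩ Icc 0 N) / ENNReal.ofReal N) atTop

/-- `f` is Pettis integrable with respect to `μ`: it is scalarly integrable, and over each
measurable set `E` it has a weak integral that lies in `X`. -/
def PettisIntegrable {α X : Type*} [MeasurableSpace α] [NormedAddCommGroup X] [NormedSpace ℝ X]
    (f : α → X) (μ : Measure α) : Prop :=
  (∀ φ : X →L[ℝ] ℝ, Integrable (fun a => φ (f a)) μ) ∧
    ∀ E : Set α, MeasurableSet E → ∃ x : X, ∀ φ : X →L[ℝ] ℝ, φ x = ∫ a in E, φ (f a) ∂μ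

namespace C0Semigroup

variable {X : Type*} [NormedAddCommGroup X] [NormedSpace ℝ X]

/-- Some orbit `{T_t x : t ≥ 0}` is dense. -/
def Hypercyclic (T : C0Semigroup X) : Prop :=
  ∃ x : X, Dense (range fun t : ℝ≥0 => T.op t x)

/-- `x` is a periodic point: `T_t x = x` for some `t > 0`. -/
def IsPeriodicPoint (T : C0Semigroup X) (x : X) : Prop :=
  ∃ t : ℝ≥0, 0 < t ∧ T.op t x = x

/-- Hypercyclic with a dense set of periodic points. -/
def Chaotic (T : C0Semigroup X) : Prop :=
  T.Hypercyclic ∧ Dense {x : X | T.IsPeriodicPoint x}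

/-- Some orbit visits every nonempty open set with positive lower density. -/
def FrequentlyHypercyclic (T : C0Semigroup X) : Prop :=
  ∃ x : X, ∀ U : Set X, IsOpen U → U.Nonempty →
    0 < lowerDensity {t : ℝ | 0 ≤ t ∧ T.op t.toNNReal x ∈ U}

/-- The Frequent Hypercyclicity Criterion for semigroups: there are a dense set `X₀` and maps
`S_t : X₀ → X₀`, `t > 0`, such that `T_t S_t x = x` and `T_t S_r x = S_{r-t} x` for `r > t > 0`,
and `t ↦ T_t x`, `t ↦ S_t x` are Pettis integrable on `[0, ∞)`, for all `x ∈ X₀`.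
(The value `S 0` is irrelevant: no identity mentions it, and `{0}` is a null set.) -/
def FrequentHypercyclicityCriterion (T : C0Semigroup X) : Prop :=
  ∃ (X₀ : Set X) (S : ℝ≥0 → X₀ → X₀), Dense X₀ ∧
    (∀ (x : X₀) (t : ℝ≥0), 0 < t → T.op t (S t x) = x) ∧
    (∀ (x : X₀) (t r : ℝ≥0), 0 < t → t < r → T.op t (S r x) = S (r - t) x) ∧
    (∀ x : X₀, PettisIntegrable (fun t : ℝ => T.op t.toNNReal x) (volume.restrict (Ici 0))) ∧
    (∀ x : X₀, PettisIntegrable (fun t : ℝ => (S t.toNNReal x : X)) (volume.restrict (Ici 0)))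

end C0Semigroup

/-- Admissible weight functions on `ℝ`. (For functions `ℝ → ℝ`, `AEMeasurable ρ volume` is
Lebesgue measurability.) -/
structure IsAdmissibleWeight (ρ : ℝ → ℝ) : Prop where
  aemeasurable : AEMeasurable ρ volume
  pos : ∀ x, 0 < ρ x
  bound : ∃ M ω : ℝ, 1 ≤ M ∧ ∀ τ t : ℝ, 0 < t → ρ τ ≤ M * Real.exp (ω * t) * ρ (τ + t)

/-- The measure `ρ(t) dt` on `ℝ`. -/
noncomputable def weightedMeasure (ρ : ℝ → ℝ) : Measure ℝ :=
  volume.withDensity fun x => ENNReal.ofReal (ρ x)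

/-- The real Banach space `L_p^ρ(ℝ)`, with norm `(∫ |u(t)|^p ρ(t) dt)^(1/p)` for `1 ≤ p < ∞`. -/
noncomputable abbrev WeightedLp (p : ℝ≥0∞) (ρ : ℝ → ℝ) : Type :=
  Lp ℝ p (weightedMeasure ρ)

namespace IsAdmissibleWeight

variable {ρ : ℝ → ℝ} {p : ℝ≥0∞}

/-- Translation distorts `ρ(t) dt` by at most a constant, locally uniformly in `t ≥ 0`. -/
theorem exists_map_le (h : IsAdmissibleWeight ρ) :
    ∃ M ω : ℝ, ∀ t : ℝ≥0, (weightedMeasure ρ).map (fun x => x + (t : ℝ)) ≤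
      ENNReal.ofReal (M * Real.exp (ω * t)) • weightedMeasure ρ := by
  obtain ⟨M, ω, hM, hb⟩ := h.bound
  refine ⟨M, ω, fun t => ?_⟩
  have hb' : ∀ x : ℝ, ENNReal.ofReal (ρ x) ≤
      ENNReal.ofReal (M * Real.exp (ω * t)) * ENNReal.ofReal (ρ (x + t)) := by
    intro x
    rw [← ENNReal.ofReal_mul (by positivity)]
    apply ENNReal.ofReal_le_ofReal
    rcases eq_or_lt_of_le (NNReal.coe_nonneg t) with ht | ht
    · rw [← ht]
      have := h.pos x
      simp only [mul_zero, Real.exp_zero, mul_one, add_zero]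
      nlinarith
    · exact hb x t ht
  rw [Measure.le_iff]
  intro s hs
  have hm : Measurable fun x : ℝ => x + (t : ℝ) := measurable_id.add_const _
  have hρ : AEMeasurable (fun x => ENNReal.ofReal (ρ x)) volume := h.aemeasurable.ennreal_ofReal
  rw [Measure.map_apply hm hs, Measure.smul_apply, weightedMeasure,
    withDensity_apply _ (hm hs), withDensity_apply _ hs, smul_eq_mul,
    ← lintegral_const_mul' _ _ ENNReal.ofReal_ne_top]
  refine (lintegral_mono fun x => hb' x).trans (le_of_eq ?_)
  exact (measurePreserving_add_right volume (t : ℝ)).setLIntegral_comp_preimage_emb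
    (measurableEmbedding_addRight (t : ℝ))
    (fun y => ENNReal.ofReal (M * Real.exp (ω * t)) * ENNReal.ofReal (ρ y)) s

theorem ae_translate (h : IsAdmissibleWeight ρ) (t : ℝ≥0) {P : ℝ → Prop}
    (hP : ∀ᵐ x ∂weightedMeasure ρ, P x) : ∀ᵐ x ∂weightedMeasure ρ, P (x + t) := by
  obtain ⟨M, ω, hC⟩ := h.exists_map_le
  exact ae_of_ae_map (measurable_id.add_const (t : ℝ)).aemeasurable
    ((Measure.absolutelyContinuous_of_le_smul (hC t)).ae_le hP)

theorem memLp_translate (h : IsAdmissibleWeight ρ) (t : ℝ≥0) {f : ℝ → ℝ}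
    (hf : MemLp f p (weightedMeasure ρ)) :
    MemLp (fun x => f (x + t)) p (weightedMeasure ρ) := by
  obtain ⟨M, ω, hC⟩ := h.exists_map_le
  exact (hf.of_measure_le_smul ENNReal.ofReal_ne_top (hC t)).comp_of_map
    (measurable_id.add_const (t : ℝ)).aemeasurable

theorem exists_eLpNorm_translate_le (h : IsAdmissibleWeight ρ) (hp : p ≠ ∞) :
    ∃ M ω : ℝ, ∀ (t : ℝ≥0) (f : ℝ → ℝ), MemLp f p (weightedMeasure ρ) →
      eLpNorm (fun x => f (x + t)) p (weightedMeasure ρ) ≤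
        ENNReal.ofReal (M * Real.exp (ω * t)) ^ (1 / p).toReal *
          eLpNorm f p (weightedMeasure ρ) := by
  obtain ⟨M, ω, hC⟩ := h.exists_map_le
  refine ⟨M, ω, fun t f hf => ?_⟩
  have h1 := eLpNorm_map_measure (p := p)
    (hf.of_measure_le_smul ENNReal.ofReal_ne_top (hC t)).aestronglyMeasurable
    (measurable_id.add_const (t : ℝ)).aemeasurable
  calc eLpNorm (fun x => f (x + t)) p (weightedMeasure ρ)
      = eLpNorm f p ((weightedMeasure ρ).map fun x => x + (t : ℝ)) := h1.symm
    _ ≤ eLpNorm f p (ENNReal.ofReal (M * Real.exp (ω * t)) • weightedMeasure ρ) :=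
        eLpNorm_mono_measure _ (hC t)
    _ = _ := by rw [eLpNorm_smul_measure_of_ne_top hp, smul_eq_mul]

theorem isLocallyFiniteMeasure (h : IsAdmissibleWeight ρ) :
    IsLocallyFiniteMeasure (weightedMeasure ρ) := by
  obtain ⟨M, ω, hM, hb⟩ := h.bound
  refine ⟨fun x => ⟨Ioo (x - 1) (x + 1), Ioo_mem_nhds (by linarith) (by linarith), ?_⟩⟩
  rw [weightedMeasure, withDensity_apply _ measurableSet_Ioo]
  have key : ∀ y ∈ Ioo (x - 1) (x + 1),
      ENNReal.ofReal (ρ y) ≤ ENNReal.ofReal (M * Real.exp (|ω| * 2) * ρ (x + 1)) := by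
    intro y hy
    apply ENNReal.ofReal_le_ofReal
    have h1 := hb y (x + 1 - y) (by linarith [hy.2])
    rw [add_sub_cancel] at h1
    refine h1.trans ?_
    have h2 : ω * (x + 1 - y) ≤ |ω| * 2 :=
      mul_le_mul (le_abs_self ω) (by linarith [hy.1]) (by linarith [hy.2]) (abs_nonneg ω)
    have := (h.pos (x + 1)).le
    gcongr
  refine (setLIntegral_mono' measurableSet_Ioo key).trans_lt ?_
  rw [setLIntegral_const]
  exact ENNReal.mul_lt_top ENNReal.ofReal_lt_top (by simp)

section Semigroup

/-- The translation `(T_t f)(x) = f(x + t)` as a map on `L_p^ρ(ℝ)`. -/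
noncomputable def translateFun (h : IsAdmissibleWeight ρ) (t : ℝ≥0) (f : WeightedLp p ρ) :
    WeightedLp p ρ :=
  (h.memLp_translate t (Lp.memLp f)).toLp (fun x => f (x + t))

theorem translateFun_ae_eq (h : IsAdmissibleWeight ρ) (t : ℝ≥0) (f : WeightedLp p ρ) :
    h.translateFun t f =ᵐ[weightedMeasure ρ] fun x => f (x + t) :=
  MemLp.coeFn_toLp (h.memLp_translate t (Lp.memLp f))

theorem translateFun_add (h : IsAdmissibleWeight ρ) (t : ℝ≥0) (f g : WeightedLp p ρ) :
    h.translateFun t (f + g) = h.translateFun t f + h.translateFun t g := by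
  apply Lp.ext
  filter_upwards [h.translateFun_ae_eq t (f + g), h.translateFun_ae_eq t f,
    h.translateFun_ae_eq t g, Lp.coeFn_add (h.translateFun t f) (h.translateFun t g),
    h.ae_translate t (Lp.coeFn_add f g)] with x h1 h2 h3 h4 h5
  rw [h1, h4, h5, Pi.add_apply, Pi.add_apply, h2, h3]

theorem translateFun_smul (h : IsAdmissibleWeight ρ) (t : ℝ≥0) (c : ℝ) (f : WeightedLp p ρ) :
    h.translateFun t (c • f) = c • h.translateFun t f := by
  apply Lp.ext
  filter_upwards [h.translateFun_ae_eq t (c • f), h.translateFun_ae_eq t f,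
    Lp.coeFn_smul c (h.translateFun t f), h.ae_translate t (Lp.coeFn_smul c f)] with x h1 h2 h3 h4
  rw [h1, h3, h4, Pi.smul_apply, Pi.smul_apply, h2]

theorem exists_norm_translateFun_le (h : IsAdmissibleWeight ρ) (hp : p ≠ ∞) (t : ℝ≥0) :
    ∃ C : ℝ, ∀ f : WeightedLp p ρ, ‖h.translateFun t f‖ ≤ C * ‖f‖ := by
  obtain ⟨M, ω, hC⟩ := h.exists_eLpNorm_translate_le hp
  refine ⟨(ENNReal.ofReal (M * Real.exp (ω * t)) ^ (1 / p).toReal).toReal, fun f => ?_⟩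
  rw [translateFun, Lp.norm_toLp, Lp.norm_def, ← ENNReal.toReal_mul]
  refine ENNReal.toReal_mono (ENNReal.mul_ne_top ?_ (Lp.eLpNorm_ne_top f)) (hC t f (Lp.memLp f))
  exact ENNReal.rpow_ne_top_of_nonneg ENNReal.toReal_nonneg ENNReal.ofReal_ne_top

variable [Fact (1 ≤ p)]

/-- The translation operator `(T_t f)(x) = f(x + t)` as a continuous linear operator on
`L_p^ρ(ℝ)`. -/
noncomputable def translate (h : IsAdmissibleWeight ρ) (hp : p ≠ ∞) (t : ℝ≥0) :
    WeightedLp p ρ →L[ℝ] WeightedLp p ρ :=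
  LinearMap.mkContinuousOfExistsBound
    { toFun := h.translateFun t
      map_add' := h.translateFun_add t
      map_smul' := h.translateFun_smul t }
    (h.exists_norm_translateFun_le hp t)

theorem translate_ae_eq (h : IsAdmissibleWeight ρ) (hp : p ≠ ∞) (t : ℝ≥0) (f : WeightedLp p ρ) :
    h.translate hp t f =ᵐ[weightedMeasure ρ] fun x => f (x + t) :=
  h.translateFun_ae_eq t f

/-- Strong continuity of the translations at `0`. -/
theorem tendsto_translate (h : IsAdmissibleWeight ρ) (hp : p ≠ ∞) (f : WeightedLp p ρ) :
    Tendsto (fun t : ℝ≥0 => h.translate hp t f) (𝓝 0) (𝓝 f) := by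
  have := h.isLocallyFiniteMeasure
  obtain ⟨M, ω, hC⟩ := h.exists_eLpNorm_translate_le hp
  set μ := weightedMeasure ρ with hμ
  have hr : 0 ≤ (1 / p).toReal := ENNReal.toReal_nonneg
  have hp1 : (1 : ℝ≥0∞) ≤ p := Fact.out
  rw [Lp.tendsto_Lp_iff_tendsto_eLpNorm', ENNReal.tendsto_nhds_zero]
  intro ε hε
  by_cases hεt : ε = ∞
  · simp [hεt]
  -- a bound for the translations with small `t`
  obtain ⟨K, hK⟩ : ∃ K : ℝ≥0, ∀ᶠ t : ℝ≥0 in 𝓝 0,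
      ENNReal.ofReal (M * Real.exp (ω * t)) ^ (1 / p).toReal ≤ K := by
    have hc : Tendsto (fun t : ℝ≥0 => M * Real.exp (ω * t)) (𝓝 0) (𝓝 M) := by
      have : Continuous fun t : ℝ≥0 => M * Real.exp (ω * t) := by fun_prop
      simpa using this.tendsto 0
    refine ⟨(ENNReal.ofReal (M + 1) ^ (1 / p).toReal).toNNReal, ?_⟩
    filter_upwards [hc.eventually_lt_const (lt_add_one M)] with t ht
    rw [ENNReal.coe_toNNReal (ENNReal.rpow_ne_top_of_nonneg hr ENNReal.ofReal_ne_top)]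
    exact ENNReal.rpow_le_rpow (ENNReal.ofReal_le_ofReal ht.le) hr
  -- approximation by a continuous function with compact support
  obtain ⟨g, hgs, hfg, hgc, hgm⟩ := (Lp.memLp f).exists_hasCompactSupport_eLpNorm_sub_le hp
    (ε := ε / 2 / (K + 1)) (by
      have h2 : (ε / 2 : ℝ≥0∞) ≠ 0 := by simp [hε.ne']
      exact (ENNReal.div_pos h2 (by simp)).ne')
  have hsmall : (K + 1 : ℝ≥0∞) * eLpNorm (⇑f - g) p μ ≤ ε / 2 := by
    refine (mul_le_mul_right hfg _).trans ?_
    rw [ENNReal.mul_div_cancel (by simp) (by simp)]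
  -- the compactly supported function
  have hcpt : IsCompact (Metric.cthickening 1 (tsupport g)) := hgs.isCompact.cthickening
  have hμfin : μ (Metric.cthickening 1 (tsupport g)) ≠ ∞ := hcpt.measure_lt_top.ne
  have hg : ∀ᶠ t : ℝ≥0 in 𝓝 0, eLpNorm ((fun x => g (x + t)) - g) p μ ≤ ε / 2 := by
    have hq : 0 ≤ 1 / p.toReal := by positivity
    set A : ℝ≥0∞ := μ (Metric.cthickening 1 (tsupport g)) ^ (1 / p.toReal) with hA
    have hAt : A ≠ ∞ := ENNReal.rpow_ne_top_of_nonneg hq hμfin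
    obtain ⟨c, hc0, hcA⟩ : ∃ c : ℝ, 0 < c ∧ ENNReal.ofReal c * A ≤ ε / 2 := by
      have hε2 : (0 : ℝ≥0∞) < ε / 2 := by simp [hε.ne']
      have : Tendsto (fun c : ℝ => ENNReal.ofReal c * A) (𝓝[>] 0) (𝓝 0) := by
        have h1 : Tendsto (fun c : ℝ => ENNReal.ofReal c) (𝓝[>] 0) (𝓝 0) := by
          simpa using (ENNReal.continuous_ofReal.tendsto 0).mono_left nhdsWithin_le_nhds
        simpa using ENNReal.Tendsto.mul_const h1 (Or.inr hAt)
      obtain ⟨c, hc, hc0⟩ := ((this.eventually (Iio_mem_nhds hε2)).and self_mem_nhdsWithin).exists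
      exact ⟨c, hc0, le_of_lt hc⟩
    obtain ⟨δ, hδ0, hδ⟩ := Metric.uniformContinuous_iff.1
      (hgs.uniformContinuous_of_continuous hgc) c hc0
    have hball : ∀ᶠ t : ℝ≥0 in 𝓝 0, (t : ℝ) < min δ 1 := by
      have : Tendsto (fun t : ℝ≥0 => (t : ℝ)) (𝓝 0) (𝓝 0) := by
        simpa using NNReal.continuous_coe.tendsto 0
      exact this.eventually_lt_const (lt_min hδ0 one_pos)
    filter_upwards [hball] with t ht
    have ht0 : (0 : ℝ) ≤ t := t.2
    refine (eLpNorm_sub_le_of_dist_bdd μ hp hcpt.measurableSet hc0.le (fun x => ?_) ?_ ?_).trans hcA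
    · refine (hδ ?_).le
      rw [Real.dist_eq, add_sub_cancel_left, abs_of_nonneg ht0]
      exact ht.trans_le (min_le_left _ _)
    · intro x hx
      refine Metric.mem_cthickening_of_dist_le x (x + t) 1 _ (subset_tsupport g hx) ?_
      rw [Real.dist_eq, sub_add_cancel_left, abs_neg, abs_of_nonneg ht0]
      exact (ht.trans_le (min_le_right _ _)).le
    · exact (subset_tsupport g).trans (Metric.self_subset_cthickening _)
  filter_upwards [hK, hg] with t htK htg
  have hd : MemLp (⇑f - g) p μ := (Lp.memLp f).sub hgm
  have hgt : MemLp (fun x => g (x + t)) p μ := h.memLp_translate t hgm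
  have e1 : eLpNorm (⇑(h.translate hp t f) - ⇑f) p μ =
      eLpNorm ((fun x => (⇑f - g) (x + t)) + (((fun x => g (x + t)) - g) + (g - ⇑f))) p μ := by
    apply eLpNorm_congr_ae
    filter_upwards [h.translate_ae_eq hp t f] with x hx
    simp only [Pi.sub_apply, Pi.add_apply, hx]
    ring
  rw [e1]
  have hd' : MemLp (fun x => (⇑f - g) (x + t)) p μ := h.memLp_translate t hd
  calc _ ≤ eLpNorm (fun x => (⇑f - g) (x + t)) p μ +
        (eLpNorm ((fun x => g (x + t)) - g) p μ + eLpNorm (g - ⇑f) p μ) := by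
        refine (eLpNorm_add_le hd'.aestronglyMeasurable
          ((hgt.sub hgm).add (hgm.sub (Lp.memLp f))).aestronglyMeasurable hp1).trans ?_
        gcongr
        exact eLpNorm_add_le (hgt.sub hgm).aestronglyMeasurable
          (hgm.sub (Lp.memLp f)).aestronglyMeasurable hp1
    _ ≤ K * eLpNorm (⇑f - g) p μ + (ε / 2 + eLpNorm (⇑f - g) p μ) := by
        rw [eLpNorm_sub_comm g (⇑f)]
        gcongr
        refine (hC t _ hd).trans ?_
        gcongr
    _ = ((K : ℝ≥0∞) + 1) * eLpNorm (⇑f - g) p μ + ε / 2 := by ring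
    _ ≤ ε / 2 + ε / 2 := by gcongr
    _ = ε := ENNReal.add_halves ε

/-- The translation semigroup on `L_p^ρ(ℝ)`. -/
noncomputable def translationSemigroup (h : IsAdmissibleWeight ρ) (hp : p ≠ ∞) :
    C0Semigroup (WeightedLp p ρ) where
  op := h.translate hp
  op_zero := by
    ext1 f
    apply Lp.ext
    filter_upwards [h.translate_ae_eq hp 0 f] with x hx
    simpa using hx
  op_add s t := by
    ext1 f
    apply Lp.ext
    rw [ContinuousLinearMap.comp_apply]
    filter_upwards [h.translate_ae_eq hp (s + t) f,
      h.translate_ae_eq hp s (h.translate hp t f),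
      h.ae_translate s (h.translate_ae_eq hp t f)] with x h1 h2 h3
    rw [h1, h2, h3, NNReal.coe_add, add_assoc]
  tendsto_zero := h.tendsto_translate hp

end Semigroup

end IsAdmissibleWeight

/-! Integrability of `ρ` is the hub of the equivalences. It agrees with summability over `ℤ`,
because admissibility makes the values of `ρ` at the two ends of a bounded interval control it from
below and above in between (`integrable_iff_summable`).

Integrability is sufficient because `ρ(t) dt` is then a finite measure: a bounded function vanishing
near the origin has small norm, however many bumps it consists of (`norm_toLp_le_tailNorm`).
Periodizing a bump with a long period therefore barely changes it, so periodic points are dense.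
Signed sums of translates of a bump are uniformly small far out, so two-sided trajectories are
Pettis integrable (`pettisIntegrable_shiftLp`). A frequently hypercyclic vector is written down
directly, as a sum of copies of test functions placed along sparse, mutually separated sets of
integers of positive density (`exists_approximating_orbit`).

Chaos and the Criterion each yield a nonzero periodic point. This is immediate for chaos; under the
Criterion one takes the weak integral of a two-sided trajectory over a periodic set of times
(`FrequentHypercyclicityCriterion.exists_isPeriodicPoint`). A nonzero periodic function puts the
same positive mass in every period, so its finite norm forces `ρ` to be summable along multiples of
the period (`integrable_of_isPeriodicPoint`).

Frequent hypercyclicity needs more, since the visits fill only a set `A` of positive density. Let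
the orbit of `x` visit a ball around the indicator of `[0, 1]`. Then `x` has mass bounded below near
each visit time, while its norm seen from any one visit time is bounded. Hence the sums of `ρ` over
`A - n` are bounded uniformly in `n ∈ A`. Averaging over `n` bounds the sum of `ρ` over the
differences `k` that occur with positive frequency. These form a syndetic set, and admissibility
spreads the bound to all of `ℤ` (`summable_of_sum_sub_le`). -/

/-! ### Correlations and difference sets of integer sets of positive density. -/

section Combinatorics

/-- A lower bound for the size of a union of translates of `B` in terms of the correlations
of `B`. -/
theorem card_biUnion_translate_ge (B K : Finset ℤ) {e : ℝ} (he0 : 0 ≤ e)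
    (he : ∀ i ∈ K, ∀ j ∈ K, i ≠ j → ((B.filter fun n => n + (i - j) ∈ B).card : ℝ) ≤ e) :
    (K.card : ℝ) * B.card - (K.card : ℝ) ^ 2 * e ≤
      ((K.biUnion fun k => B.map (addRightEmbedding k)).card : ℝ) := by
  classical
  induction K using Finset.induction_on with
  | empty => simp
  | insert a K ha ih =>
    have ih' := ih fun i hi j hj =>
      he i (Finset.mem_insert_of_mem hi) j (Finset.mem_insert_of_mem hj)
    rw [Finset.biUnion_insert, Finset.card_insert_of_notMem ha]
    set U := K.biUnion fun k => B.map (addRightEmbedding k) with hU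
    have h1 := Finset.card_union_add_card_inter (B.map (addRightEmbedding a)) U
    have h2 : ((B.map (addRightEmbedding a) ∩ U).card : ℝ) ≤ K.card * e := by
      -- A collision `n + a = m + k` says exactly that `n` and `n + (a - k)` both lie in `B`, so
      -- each earlier translate costs at most `e`.
      have h3 : B.map (addRightEmbedding a) ∩ U ⊆
          K.biUnion fun k => (B.filter fun n => n + (a - k) ∈ B).map (addRightEmbedding a) := by
        intro y hy
        simp only [hU, Finset.mem_inter, Finset.mem_map, Finset.mem_biUnion,
          addRightEmbedding_apply] at hy
        obtain ⟨⟨n, hn, rfl⟩, k, hk, m, hm, hmk⟩ := hy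
        simp only [Finset.mem_biUnion, Finset.mem_map, Finset.mem_filter, addRightEmbedding_apply]
        refine ⟨k, hk, n, ⟨hn, ?_⟩, rfl⟩
        have : n + (a - k) = m := by linarith
        rwa [this]
      have h4 := (Finset.card_le_card h3).trans Finset.card_biUnion_le
      calc ((B.map (addRightEmbedding a) ∩ U).card : ℝ)
          ≤ ∑ k ∈ K, ((B.filter fun n => n + (a - k) ∈ B).card : ℝ) := by
            have h5 : ((B.map (addRightEmbedding a) ∩ U).card : ℝ) ≤
              ((∑ k ∈ K, ((B.filter fun n => n + (a - k) ∈ B).map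
                (addRightEmbedding a)).card : ℕ) : ℝ) := by exact_mod_cast h4
            simpa only [Finset.card_map, Nat.cast_sum] using h5
        _ ≤ ∑ k ∈ K, e := Finset.sum_le_sum fun k hk =>
            he a (Finset.mem_insert_self _ _) k (Finset.mem_insert_of_mem hk)
              (fun h => ha (h ▸ hk))
        _ = K.card * e := by simp
    have h1' : ((B.map (addRightEmbedding a) ∪ U).card : ℝ) +
        ((B.map (addRightEmbedding a) ∩ U).card : ℝ) = B.card + U.card := by
      rw [Finset.card_map] at h1
      exact_mod_cast h1
    push_cast
    have : (0 : ℝ) ≤ K.card * e := by positivity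
    nlinarith

/-- If a set `D` of integers, symmetric and containing `0`, meets the difference set of every
finite set with at least `L` elements, then finitely many translates of `D` cover `ℤ`. -/
theorem exists_finset_cover_of_differences {D : Set ℤ} (h0 : (0 : ℤ) ∈ D)
    (hsymm : ∀ k ∈ D, -k ∈ D) {L : ℕ}
    (hL : ∀ K : Finset ℤ, K.card = L → ∃ i ∈ K, ∃ j ∈ K, i ≠ j ∧ i - j ∈ D) :
    ∃ K : Finset ℤ, ∀ n : ℤ, ∃ k ∈ K, n + k ∈ D := by
  classical
  have hex : ∃ l : ℕ, ∀ K : Finset ℤ, K.card = l → ∃ i ∈ K, ∃ j ∈ K, i ≠ j ∧ i - j ∈ D := ⟨L, hL⟩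
  -- By minimality some `K` with `l - 1` elements has no difference in `D`. Adjoining `-n` creates
  -- one, which must involve `-n`, so `n + k ∈ D` for some `k ∈ K`.
  obtain ⟨l, hl, hmin⟩ : ∃ l : ℕ, (∀ K : Finset ℤ, K.card = l →
      ∃ i ∈ K, ∃ j ∈ K, i ≠ j ∧ i - j ∈ D) ∧ ∀ m < l, ¬ ∀ K : Finset ℤ, K.card = m →
      ∃ i ∈ K, ∃ j ∈ K, i ≠ j ∧ i - j ∈ D :=
    ⟨Nat.find hex, Nat.find_spec hex, fun m hm => Nat.find_min hex hm⟩
  rcases Nat.eq_zero_or_pos l with rfl | hpos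
  · obtain ⟨i, hi, -⟩ := hl ∅ rfl
    simp at hi
  have hK := hmin (l - 1) (by omega)
  push Not at hK
  obtain ⟨K, hKc, hK⟩ := hK
  refine ⟨K, fun n => ?_⟩
  by_contra! hn
  have hnK : -n ∉ K := fun h => hn (-n) h (by simpa using h0)
  obtain ⟨i, hi, j, hj, hij, hd⟩ := hl (insert (-n) K)
    (by rw [Finset.card_insert_of_notMem hnK, hKc]; omega)
  rcases Finset.mem_insert.1 hi with rfl | hi <;> rcases Finset.mem_insert.1 hj with rfl | hj
  · exact hij rfl
  · refine hn j hj ?_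
    have := hsymm _ hd
    rwa [show -(-n - j) = n + j by ring] at this
  · refine hn i hi ?_
    rwa [show i - -n = n + i by ring] at hd
  · exact hK i hi j hj hij hd

open Classical in
/-- If `A ⊆ ℤ` has positive upper density in the positive direction and the sums of `r` over
`A - n`, `n ∈ A`, are uniformly bounded, then `r` is summable, provided `r k` is dominated
by `r (k + j)` for each `j ≥ 0`. -/
theorem summable_of_sum_sub_le {r : ℤ → ℝ} (hr : ∀ k, 0 ≤ r k)
    (hmono : ∀ j : ℤ, 0 ≤ j → ∃ c : ℝ, ∀ k, r k ≤ c * r (k + j)) {A : Set ℤ} {C δ : ℝ}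
    (hδ : 0 < δ)
    (hdens : ∃ᶠ N : ℕ in atTop,
      δ * N ≤ (((Finset.Ico (0 : ℤ) N).filter (· ∈ A)).card : ℝ))
    (hA : ∀ n ∈ A, ∀ F : Finset ℤ, (∀ m ∈ F, m ∈ A) → ∑ m ∈ F, r (m - n) ≤ C) :
    Summable r := by
  set B : ℕ → Finset ℤ := fun N => (Finset.Ico (0 : ℤ) N).filter (· ∈ A) with hB
  have hne : (atTop ⊓ 𝓟 {N : ℕ | δ * N ≤ ((B N).card : ℝ)}).NeBot :=
    frequently_mem_iff_neBot.1 hdens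
  -- The ultrafilter decides for every `k` at once whether the correlation at `k` is at least `η N`;
  -- no diagonal subsequence is needed.
  set 𝒰 := Ultrafilter.of (atTop ⊓ 𝓟 {N : ℕ | δ * N ≤ ((B N).card : ℝ)})
  have hle : (𝒰 : Filter ℕ) ≤ atTop ⊓ 𝓟 {N : ℕ | δ * N ≤ ((B N).card : ℝ)} := Ultrafilter.of_le _
  have htop : (𝒰 : Filter ℕ) ≤ atTop := hle.trans inf_le_left
  have hcard : ∀ᶠ N in (𝒰 : Filter ℕ), δ * N ≤ ((B N).card : ℝ) :=
    hle.trans inf_le_right (mem_principal_self _)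
  have hBN : ∀ N, ((B N).card : ℝ) ≤ N := fun N => by
    have := Finset.card_filter_le (Finset.Ico (0 : ℤ) N) (· ∈ A)
    simp only [Int.card_Ico, sub_zero, Int.toNat_natCast] at this
    exact_mod_cast this
  -- With `η = δ / (2L)`, `L` translates of `B N` with pairwise correlations at most `η N` would
  -- have a union of at least `LδN - L²ηN = LδN/2 ≥ 3N` points. The union lies in an interval of
  -- fewer than `2N` integers once `N > 2κ`, so some difference belongs to `D`.
  obtain ⟨L, hL⟩ := exists_nat_ge (6 / δ)
  have hL0 : (0 : ℝ) < L := lt_of_lt_of_le (by positivity) hL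
  have hLδ : 6 ≤ L * δ := by rwa [div_le_iff₀ hδ] at hL
  set η : ℝ := δ / (2 * L) with hη
  have hη0 : 0 < η := by positivity
  set d : ℕ → ℤ → ℝ := fun N k => (((B N).filter fun n => n + k ∈ B N).card : ℝ) with hd
  set D : Set ℤ := {k | ∀ᶠ N in (𝒰 : Filter ℕ), η * N ≤ d N k} with hD
  have hL1 : (1 : ℝ) ≤ L := by
    have : 0 < L := by exact_mod_cast hL0
    exact_mod_cast this
  have h0 : (0 : ℤ) ∈ D := by
    filter_upwards [hcard] with N hN
    have : d N 0 = (B N).card := by simp [hd]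
    rw [this]
    refine le_trans ?_ hN
    have : η ≤ δ := div_le_self hδ.le (by linarith)
    gcongr
  have hsymm : ∀ k ∈ D, -k ∈ D := by
    intro k hk
    filter_upwards [hk] with N hN
    refine hN.trans (le_of_eq ?_)
    simp only [hd]
    congr 1
    refine Finset.card_bij (fun n _ => n + k) ?_ (fun a _ b _ h => by linarith) ?_
    · intro n hn
      simp only [Finset.mem_filter] at hn ⊢
      exact ⟨hn.2, by simpa using hn.1⟩
    · intro n hn
      simp only [Finset.mem_filter] at hn
      exact ⟨n - k, Finset.mem_filter.2 ⟨hn.2, by simpa using hn.1⟩, by ring⟩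
  have hcover : ∀ K : Finset ℤ, K.card = L → ∃ i ∈ K, ∃ j ∈ K, i ≠ j ∧ i - j ∈ D := by
    intro K hK
    by_contra! hcon
    have hev : ∀ᶠ N in (𝒰 : Filter ℕ), ∀ i ∈ K, ∀ j ∈ K, i ≠ j → d N (i - j) ≤ η * N := by
      rw [Filter.eventually_all_finset]
      intro i hi
      rw [Filter.eventually_all_finset]
      intro j hj
      by_cases hij : i = j
      · exact Eventually.of_forall fun N h => absurd hij h
      · have h1 : ¬ ∀ᶠ N in (𝒰 : Filter ℕ), η * N ≤ d N (i - j) := hcon i hi j hj hij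
        rw [← Ultrafilter.eventually_not] at h1
        filter_upwards [h1] with N hN _
        exact (not_le.1 hN).le
    obtain ⟨κ, hκ⟩ : ∃ κ : ℕ, ∀ k ∈ K, |k| ≤ κ := by
      refine ⟨K.sup Int.natAbs, fun k hk => ?_⟩
      have := Finset.le_sup (f := Int.natAbs) hk
      rw [Int.abs_eq_natAbs]
      exact_mod_cast this
    obtain ⟨N, hN1, hN2, hN3⟩ := (hev.and (hcard.and
      (htop (eventually_ge_atTop (2 * κ + 1))))).exists
    have hmain := card_biUnion_translate_ge (B N) K (e := η * N) (by positivity) hN1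
    have hub : ((K.biUnion fun k => (B N).map (addRightEmbedding k)).card : ℝ) ≤ N + 2 * κ := by
      have hsub : (K.biUnion fun k => (B N).map (addRightEmbedding k)) ⊆
          Finset.Ico (-κ : ℤ) (N + κ) := by
        intro y hy
        simp only [Finset.mem_biUnion, Finset.mem_map, addRightEmbedding_apply, hB,
          Finset.mem_filter, Finset.mem_Ico] at hy
        obtain ⟨k, hk, n, hn, rfl⟩ := hy
        have := abs_le.1 (hκ k hk)
        rw [Finset.mem_Ico]
        constructor <;> linarith
      have := Finset.card_le_card hsub
      rw [Int.card_Ico] at this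
      have h2 : ((N : ℤ) + κ - -κ).toNat = N + 2 * κ := by omega
      rw [h2] at this
      exact_mod_cast this
    have hN3' : (2 * κ + 1 : ℝ) ≤ N := by exact_mod_cast hN3
    have h5 : (L : ℝ) ^ 2 * (η * N) = L * δ / 2 * N := by
      rw [hη]; field_simp
    rw [hK, h5] at hmain
    have h6 : (L : ℝ) * (δ * N) ≤ L * (B N).card := by gcongr
    have hN0 : (0 : ℝ) < N := by have : (0 : ℝ) ≤ κ := Nat.cast_nonneg _; linarith
    have h7 : 3 * (N : ℝ) ≤ L * δ / 2 * N := by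
      have : 3 ≤ L * δ / 2 := by linarith
      gcongr
    have h8 : (L : ℝ) * (δ * N) = 2 * (L * δ / 2 * N) := by ring
    linarith
  obtain ⟨K, hK⟩ := exists_finset_cover_of_differences h0 hsymm hcover
  -- Double counting of pairs `n, n + k ∈ B N`: `η N ∑ r k` is at most the sum of `r k` over such
  -- pairs, and grouping by `n` bounds that by `C` for each of at most `N` values of `n`.
  have hsumD : Summable (D.indicator r) := by
    refine summable_of_sum_le (c := C / η) (fun k => indicator_nonneg (fun _ _ => hr _) _)
      fun F => ?_
    have hFe : ∑ k ∈ F, D.indicator r k = ∑ k ∈ F.filter (· ∈ D), r k := by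
      rw [Finset.sum_filter]
      exact Finset.sum_congr rfl fun k _ => indicator_apply _ _ _
    rw [hFe]
    set G := F.filter (· ∈ D) with hG
    have hev : ∀ᶠ N in (𝒰 : Filter ℕ), ∀ k ∈ G, η * N ≤ d N k := by
      rw [Filter.eventually_all_finset]
      exact fun k hk => (Finset.mem_filter.1 hk).2
    obtain ⟨N, hN1, hN2, hN3⟩ := (hev.and (hcard.and (htop (eventually_ge_atTop 1)))).exists
    have hN0 : (0 : ℝ) < N := by exact_mod_cast hN3
    have hBpos : (0 : ℝ) < (B N).card := lt_of_lt_of_le (by positivity) hN2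
    have hdbl : ∑ k ∈ G, r k * d N k ≤ (B N).card * C := by
      have e1 : ∑ k ∈ G, r k * d N k =
          ∑ n ∈ B N, ∑ k ∈ G.filter (fun k => n + k ∈ B N), r k := by
        simp only [Finset.sum_filter]
        rw [Finset.sum_comm]
        refine Finset.sum_congr rfl fun k _ => ?_
        rw [← Finset.sum_filter, Finset.sum_const, nsmul_eq_mul, mul_comm]
      rw [e1, ← nsmul_eq_mul]
      refine Finset.sum_le_card_nsmul _ _ _ fun n hn => ?_
      have hnA : n ∈ A := (Finset.mem_filter.1 hn).2
      have := hA n hnA ((G.filter (fun k => n + k ∈ B N)).map (addRightEmbedding n)) (by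
        intro m hm
        simp only [Finset.mem_map, Finset.mem_filter, addRightEmbedding_apply] at hm
        obtain ⟨k, ⟨_, hk⟩, rfl⟩ := hm
        rw [add_comm]
        exact (Finset.mem_filter.1 hk).2)
      simpa using this
    have hC0 : 0 ≤ C := by
      obtain ⟨n, hn⟩ : (B N).Nonempty := Finset.card_pos.1 (by exact_mod_cast hBpos)
      simpa using hA n (Finset.mem_filter.1 hn).2 ∅ (by simp)
    have h1 : (∑ k ∈ G, r k) * (η * N) ≤ N * C := by
      calc (∑ k ∈ G, r k) * (η * N) = ∑ k ∈ G, r k * (η * N) := Finset.sum_mul _ _ _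
        _ ≤ ∑ k ∈ G, r k * d N k :=
          Finset.sum_le_sum fun k hk => mul_le_mul_of_nonneg_left (hN1 k hk) (hr k)
        _ ≤ (B N).card * C := hdbl
        _ ≤ N * C := by exact mul_le_mul_of_nonneg_right (hBN N) hC0
    rw [le_div_iff₀ hη0]
    refine le_of_mul_le_mul_right ?_ hN0
    linarith
  -- Domination holds for forward shifts only, so the covering is applied at `n + κ`, which makes
  -- every shift `κ + k` nonnegative.
  obtain ⟨κ, hκ⟩ : ∃ κ : ℤ, ∀ k ∈ K, 0 ≤ κ + k := by
    refine ⟨(K.sup Int.natAbs : ℕ), fun k hk => ?_⟩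
    have := Finset.le_sup (f := Int.natAbs) hk
    have h2 : -k ≤ (k.natAbs : ℤ) := by omega
    have h3 : (k.natAbs : ℤ) ≤ (K.sup Int.natAbs : ℕ) := by exact_mod_cast this
    linarith
  choose! c hc using hmono
  have hS : Summable fun n : ℤ => ∑ k ∈ K, |c (κ + k)| * D.indicator r (n + (κ + k)) := by
    refine summable_sum fun k _ => ?_
    exact ((Equiv.addRight (κ + k)).summable_iff.2 hsumD).mul_left _
  refine Summable.of_nonneg_of_le hr (fun n => ?_) hS
  obtain ⟨k, hk, hkD⟩ := hK (n + κ)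
  have h1 : r n ≤ |c (κ + k)| * D.indicator r (n + (κ + k)) := by
    rw [indicator_of_mem (by rwa [← add_assoc])]
    exact (hc _ (hκ k hk) n).trans (mul_le_mul_of_nonneg_right (le_abs_self _) (hr _))
  exact h1.trans (Finset.single_le_sum
    (f := fun k => |c (κ + k)| * D.indicator r (n + (κ + k)))
    (fun k _ => mul_nonneg (abs_nonneg _) (indicator_nonneg (fun _ _ => hr _) _)) hk)

end Combinatorics

/-! ### Pointwise comparison of the weight; integrability against summability. -/

namespace IsAdmissibleWeight

variable {ρ : ℝ → ℝ} {p : ℝ≥0∞}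

/-- Admissibility made uniform over a window of length `a`. The comparison goes forward only: `ρ`
cannot fall too fast, but may rise arbitrarily. -/
theorem exists_le_mul (h : IsAdmissibleWeight ρ) (a : ℝ) :
    ∃ C : ℝ, 0 < C ∧ ∀ x y, x ≤ y → y ≤ x + a → ρ x ≤ C * ρ y := by
  obtain ⟨M, ω, hM, hb⟩ := h.bound
  refine ⟨M * Real.exp (|ω| * |a|), by positivity, fun x y hxy hya => ?_⟩
  have hy := h.pos y
  rcases hxy.eq_or_lt with rfl | hlt
  · have h1 : (1 : ℝ) ≤ M * Real.exp (|ω| * |a|) :=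
      one_le_mul_of_one_le_of_one_le hM (Real.one_le_exp (by positivity))
    nlinarith
  · have h1 := hb x (y - x) (by linarith)
    rw [add_sub_cancel] at h1
    refine h1.trans ?_
    have h2 : ω * (y - x) ≤ |ω| * |a| := by
      refine mul_le_mul (le_abs_self ω) ?_ (by linarith) (abs_nonneg ω)
      exact le_trans (by linarith) (le_abs_self a)
    gcongr

theorem lintegral_weightedMeasure (h : IsAdmissibleWeight ρ) {f : ℝ → ℝ≥0∞} (hf : Measurable f) :
    ∫⁻ x, f x ∂weightedMeasure ρ = ∫⁻ x, ENNReal.ofReal (ρ x) * f x := by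
  rw [weightedMeasure, lintegral_withDensity_eq_lintegral_mul₀ h.aemeasurable.ennreal_ofReal
    hf.aemeasurable]
  rfl

theorem ae_weightedMeasure (h : IsAdmissibleWeight ρ) : ae (weightedMeasure ρ) = ae volume := by
  apply le_antisymm
  · exact (withDensity_absolutelyContinuous _ _).ae_le
  · refine (withDensity_absolutelyContinuous' h.aemeasurable.ennreal_ofReal ?_).ae_le
    exact ae_of_all _ fun x => by simpa using h.pos x

theorem lintegral_eq_tsum_Ioc (μ : Measure ℝ) {a : ℝ} (ha : 0 < a) (f : ℝ → ℝ≥0∞) :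
    ∫⁻ x, f x ∂μ = ∑' k : ℤ, ∫⁻ x in Ioc (k * a) ((k + 1) * a), f x ∂μ := by
  have h1 := iUnion_Ioc_zsmul ha
  have h2 := pairwise_disjoint_Ioc_zsmul a
  rw [← setLIntegral_univ, ← h1, lintegral_iUnion (fun _ => measurableSet_Ioc) h2]
  simp only [zsmul_eq_mul, Int.cast_add, Int.cast_one]

theorem summable_of_tsum_ofReal_ne_top {ι : Type*} {f : ι → ℝ} (hf : ∀ i, 0 ≤ f i)
    (h : ∑' i, ENNReal.ofReal (f i) ≠ ∞) : Summable f := by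
  have := ENNReal.summable_toReal h
  simpa [ENNReal.toReal_ofReal (hf _)] using this

/-- On each cell `ρ` is bounded below by its value at the left end and above by its value at the
right end, up to `C`. The step `a` is arbitrary because the period of a periodic point need not be
an integer. -/
theorem integrable_iff_summable (h : IsAdmissibleWeight ρ) {a : ℝ} (ha : 0 < a) :
    Integrable ρ volume ↔ Summable fun k : ℤ => ρ (k * a) := by
  obtain ⟨C, hC, hle⟩ := h.exists_le_mul a
  have hfin : Integrable ρ volume ↔ ∫⁻ x, ENNReal.ofReal (ρ x) ≠ ∞ := by
    rw [← lt_top_iff_ne_top, ← hasFiniteIntegral_iff_ofReal (ae_of_all _ fun x => (h.pos x).le)]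
    exact ⟨fun hi => hi.2, fun hi => ⟨h.aemeasurable.aestronglyMeasurable, hi⟩⟩
  have hvol : ∀ k : ℤ, volume (Ioc (k * a) ((k + 1) * a)) = ENNReal.ofReal a := fun k => by
    rw [Real.volume_Ioc]; congr 1; ring
  rw [hfin, lintegral_eq_tsum_Ioc volume ha]
  constructor
  · intro hne
    refine summable_of_tsum_ofReal_ne_top (fun k => (h.pos _).le) ?_
    have h1 : ENNReal.ofReal (a / C) * ∑' k : ℤ, ENNReal.ofReal (ρ (k * a)) ≤
        ∑' k : ℤ, ∫⁻ x in Ioc (k * a) ((k + 1) * a), ENNReal.ofReal (ρ x) := by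
      rw [← ENNReal.tsum_mul_left]
      refine ENNReal.tsum_le_tsum fun k => ?_
      have h2 : ∀ x ∈ Ioc (k * a) ((k + 1) * a),
          ENNReal.ofReal (ρ (k * a) / C) ≤ ENNReal.ofReal (ρ x) := by
        intro x hx
        apply ENNReal.ofReal_le_ofReal
        rw [div_le_iff₀' hC]
        exact hle _ _ hx.1.le (by linarith [hx.2])
      refine le_trans (le_of_eq ?_) (setLIntegral_mono' measurableSet_Ioc h2)
      rw [setLIntegral_const, hvol, ← ENNReal.ofReal_mul (by positivity),
        ← ENNReal.ofReal_mul (div_nonneg (h.pos _).le hC.le)]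
      congr 1; ring
    intro htop
    rw [htop, ENNReal.mul_top (by simp; positivity)] at h1
    exact hne (top_le_iff.1 h1)
  · intro hs
    have hs' : Summable fun k : ℤ => ρ ((k + 1) * a) * (C * a) := by
      have := (Equiv.addRight (1 : ℤ)).summable_iff.2 hs
      refine Summable.mul_right _ ?_
      simpa [Function.comp_def] using this
    refine ne_top_of_le_ne_top hs'.tsum_ofReal_ne_top (ENNReal.tsum_le_tsum fun k => ?_)
    have h2 : ∀ x ∈ Ioc (k * a) ((k + 1) * a),
        ENNReal.ofReal (ρ x) ≤ ENNReal.ofReal (C * ρ ((k + 1) * a)) := fun x hx =>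
      ENNReal.ofReal_le_ofReal (hle _ _ hx.2 (by linarith [hx.1]))
    refine (setLIntegral_mono' measurableSet_Ioc h2).trans (le_of_eq ?_)
    rw [setLIntegral_const, hvol, ← ENNReal.ofReal_mul (mul_nonneg hC.le (h.pos _).le)]
    congr 1; ring

end IsAdmissibleWeight

/-! ### Frequent hypercyclicity implies summability. -/

-- Each unit cell meeting `A` carries at most mass one of `A`, so the number of such cells in `[0,
-- N)` is at least the measure of `A ∩ [0, N]`.
open Classical in
theorem exists_density_of_lowerDensity_pos {A : Set ℝ} (hA : 0 < lowerDensity A) :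
    ∃ δ : ℝ, 0 < δ ∧ ∀ᶠ N : ℕ in atTop, δ * N ≤
      (((Finset.Ico (0 : ℤ) N).filter (· ∈ {n : ℤ | ∃ t ∈ A, n ≤ t ∧ t < n + 1})).card : ℝ) := by
  obtain ⟨c, hc0, hc⟩ := exists_between hA
  have hct : c ≠ ∞ := (hc.trans_le le_top).ne
  refine ⟨c.toReal, ENNReal.toReal_pos hc0.ne' hct, ?_⟩
  filter_upwards [tendsto_natCast_atTop_atTop.eventually (eventually_lt_of_lt_liminf hc)] with N hN
  set B := (Finset.Ico (0 : ℤ) N).filter (· ∈ {n : ℤ | ∃ t ∈ A, n ≤ t ∧ t < n + 1}) with hB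
  have hsub : A ∩ Icc 0 (N : ℝ) ⊆ {(N : ℝ)} ∪ ⋃ n ∈ B, Ico (n : ℝ) (n + 1) := by
    rintro t ⟨htA, ht0, htN⟩
    rcases htN.eq_or_lt with rfl | hlt
    · exact Or.inl rfl
    · refine Or.inr (mem_iUnion₂.2 ⟨⌊t⌋, ?_, Int.floor_le t, Int.lt_floor_add_one t⟩)
      simp only [hB, Finset.mem_filter, Finset.mem_Ico]
      refine ⟨⟨Int.floor_nonneg.2 ht0, ?_⟩, t, htA, Int.floor_le t, Int.lt_floor_add_one t⟩
      rw [Int.floor_lt]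
      simpa using hlt
  have hvol : volume (A ∩ Icc 0 (N : ℝ)) ≤ B.card := by
    refine (measure_mono hsub).trans ((measure_union_le _ _).trans ?_)
    rw [Real.volume_singleton, zero_add]
    refine (measure_biUnion_finset_le _ _).trans ?_
    simp
  have h1 : c * ENNReal.ofReal N ≤ B.card := by
    refine le_trans ?_ hvol
    exact ENNReal.mul_le_of_le_div hN.le
  have h2 : (c * ENNReal.ofReal N).toReal ≤ (B.card : ℝ≥0∞).toReal :=
    ENNReal.toReal_mono (by simp) h1
  rwa [ENNReal.toReal_mul, ENNReal.toReal_ofReal (Nat.cast_nonneg _), ENNReal.toReal_natCast] at h2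

namespace IsAdmissibleWeight

variable {ρ : ℝ → ℝ} {p : ℝ≥0∞} [Fact (1 ≤ p)]

/-- If `T_t x` is near the indicator of `[0, 1]`, then `|x|^p` has mass at least `c0` on `[t, t +
1]`. Testing the bounded norm of `T_t x` against the masses near all other visit times bounds the
sums of `ρ` over differences of visit times. -/
theorem summable_of_frequentlyHypercyclic (h : IsAdmissibleWeight ρ) (hp : p ≠ ∞)
    (hT : (h.translationSemigroup hp : C0Semigroup (WeightedLp p ρ)).FrequentlyHypercyclic) :
    Summable fun k : ℤ => ρ k := by
  classical
  have := h.isLocallyFiniteMeasure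
  have hp0 : p ≠ 0 := (zero_lt_one.trans_le (Fact.out : (1 : ℝ≥0∞) ≤ p)).ne'
  have hp1 : (1 : ℝ≥0∞) ≤ p := Fact.out
  have hpr : 0 < p.toReal := ENNReal.toReal_pos hp0 hp
  obtain ⟨x, hx⟩ := hT
  set μ := weightedMeasure ρ with hμ
  have hIfin : μ (Icc (0 : ℝ) 1) ≠ ∞ := isCompact_Icc.measure_lt_top.ne
  have hIpos : μ (Icc (0 : ℝ) 1) ≠ 0 := by
    have : ¬ (∀ᵐ y ∂μ, y ∉ Icc (0 : ℝ) 1) := by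
      rw [h.ae_weightedMeasure, ← measure_eq_zero_iff_ae_notMem]
      simp
    rwa [← measure_eq_zero_iff_ae_notMem] at this
  set e : WeightedLp p ρ := indicatorConstLp p measurableSet_Icc hIfin (1 : ℝ) with he
  have he0 : e ≠ 0 := by
    intro h0
    have := norm_indicatorConstLp (p := p) (μ := μ) (hs := measurableSet_Icc) (hμs := hIfin)
      (c := (1 : ℝ)) hp0 hp
    rw [← he, h0, norm_zero, norm_one, one_mul] at this
    have h2 : (0 : ℝ) < μ.real (Icc (0 : ℝ) 1) := ENNReal.toReal_pos hIpos hIfin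
    exact (Real.rpow_pos_of_pos h2 (1 / p.toReal)).ne this
  have hnpos : 0 < ‖e‖ := norm_pos_iff.2 he0
  have hd := hx (Metric.ball e (‖e‖ / 2)) Metric.isOpen_ball
    ⟨e, Metric.mem_ball_self (by positivity)⟩
  set A : Set ℝ := {t : ℝ | 0 ≤ t ∧
    (h.translationSemigroup hp).op t.toNNReal x ∈ Metric.ball e (‖e‖ / 2)} with hA
  obtain ⟨δ, hδ, hdens⟩ := exists_density_of_lowerDensity_pos hd
  set g : ℝ → ℝ≥0∞ := fun y => ‖x y‖ₑ ^ p.toReal with hg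
  have hgm : Measurable g := (Lp.stronglyMeasurable x).measurable.enorm.pow_const _
  -- the two estimates for `t ∈ A`
  obtain ⟨C0, hC0, hC0A⟩ : ∃ C0 : ℝ≥0∞, C0 ≠ ∞ ∧ ∀ t ∈ A,
      ∫⁻ y, ENNReal.ofReal (ρ (y - t)) * g y ≤ C0 := by
    refine ⟨(ENNReal.ofReal (‖e‖ + ‖e‖ / 2)) ^ p.toReal,
      ENNReal.rpow_ne_top_of_nonneg hpr.le ENNReal.ofReal_ne_top, fun t ht => ?_⟩
    have h1 : eLpNorm (fun y => x (y + t.toNNReal)) p μ ≤ ENNReal.ofReal (‖e‖ + ‖e‖ / 2) := by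
      rw [← eLpNorm_congr_ae (h.translate_ae_eq hp t.toNNReal x), ← Lp.enorm_def,
        ← ofReal_norm]
      apply ENNReal.ofReal_le_ofReal
      have h2 : ‖h.translate hp t.toNNReal x - e‖ < ‖e‖ / 2 := mem_ball_iff_norm.1 ht.2
      have h3 := norm_le_norm_add_norm_sub' (h.translate hp t.toNNReal x) e
      linarith
    rw [eLpNorm_eq_lintegral_rpow_enorm_toReal hp0 hp, one_div,
      ENNReal.rpow_inv_le_iff hpr] at h1
    have h4 : (∫⁻ y, ‖x (y + t.toNNReal)‖ₑ ^ p.toReal ∂μ) =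
        ∫⁻ y, ENNReal.ofReal (ρ y) * g (y + t) := by
      rw [Real.coe_toNNReal _ ht.1]
      exact h.lintegral_weightedMeasure (hgm.comp (measurable_id.add_const t))
    rw [h4] at h1
    refine le_trans (le_of_eq ?_) h1
    rw [← lintegral_add_right_eq_self _ t]
    simp
  obtain ⟨c0, hc0, hc0A⟩ : ∃ c0 : ℝ≥0∞, c0 ≠ 0 ∧ ∀ t ∈ A, c0 ≤ ∫⁻ y in Icc t (t + 1), g y := by
    obtain ⟨C, hC, hle⟩ := h.exists_le_mul 1
    set K : ℝ≥0∞ := ENNReal.ofReal (C * ρ 1) with hK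
    -- Since `e` lives on `[0, 1]` and `‖e - f‖ < ‖e‖ / 2`, the part of `f` on `[0, 1]` has norm at
    -- least `‖e‖ / 2`. The factor `K` bounds `ρ` on `[0, 1]` and converts weighted mass to Lebesgue
    -- mass.
    refine ⟨K⁻¹ * (ENNReal.ofReal (‖e‖ / 2)) ^ p.toReal, ?_, fun t ht => ?_⟩
    · refine mul_ne_zero (by simp [hK]) ?_
      exact (ENNReal.rpow_pos (by simpa using hnpos) ENNReal.ofReal_ne_top).ne'
    set f : WeightedLp p ρ := h.translate hp t.toNNReal x with hf
    have h2 : ‖e - f‖ < ‖e‖ / 2 := by rw [norm_sub_rev]; exact mem_ball_iff_norm.1 ht.2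
    have h3 : eLpNorm e p μ ≤ eLpNorm f p (μ.restrict (Icc 0 1)) + ENNReal.ofReal (‖e‖ / 2) := by
      have h4 : eLpNorm e p μ = eLpNorm e p (μ.restrict (Icc 0 1)) := by
        rw [← eLpNorm_indicator_eq_eLpNorm_restrict measurableSet_Icc]
        apply eLpNorm_congr_ae
        filter_upwards [indicatorConstLp_coeFn (p := p) (μ := μ) (hs := measurableSet_Icc)
          (hμs := hIfin) (c := (1 : ℝ))] with y hy
        rw [indicator_apply]
        split_ifs with hyI
        · rfl
        · rw [he, hy, indicator_of_notMem hyI]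
      have h5 : eLpNorm e p (μ.restrict (Icc 0 1)) ≤
          eLpNorm f p (μ.restrict (Icc 0 1)) + eLpNorm (⇑e - ⇑f) p (μ.restrict (Icc 0 1)) := by
        refine le_trans (le_of_eq ?_) (eLpNorm_add_le (Lp.aestronglyMeasurable f).restrict
          ((Lp.aestronglyMeasurable e).sub (Lp.aestronglyMeasurable f)).restrict hp1)
        congr 1
        ext y
        simp
      rw [h4]
      refine h5.trans (add_le_add le_rfl ?_)
      refine (eLpNorm_mono_measure _ Measure.restrict_le_self).trans ?_
      rw [← eLpNorm_congr_ae (Lp.coeFn_sub e f), ← Lp.enorm_def, ← ofReal_norm]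
      exact ENNReal.ofReal_le_ofReal h2.le
    have h6 : ENNReal.ofReal (‖e‖ / 2) ≤ eLpNorm f p (μ.restrict (Icc 0 1)) := by
      rw [← Lp.enorm_def, ← ofReal_norm] at h3
      have h7 : ENNReal.ofReal ‖e‖ = ENNReal.ofReal (‖e‖ / 2) + ENNReal.ofReal (‖e‖ / 2) := by
        rw [← ENNReal.ofReal_add (by positivity) (by positivity), add_halves]
      rw [h7] at h3
      exact (ENNReal.add_le_add_iff_right ENNReal.ofReal_ne_top).1 h3
    have h8 : ENNReal.ofReal (‖e‖ / 2) ^ p.toReal ≤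
        ∫⁻ y in Icc 0 1, g (y + t) ∂μ := by
      rw [eLpNorm_congr_ae (ae_restrict_of_ae (h.translate_ae_eq hp t.toNNReal x)),
        eLpNorm_eq_lintegral_rpow_enorm_toReal hp0 hp, one_div, ENNReal.le_rpow_inv_iff hpr,
        Real.coe_toNNReal _ ht.1] at h6
      exact h6
    have h9 : ∫⁻ y in Icc 0 1, g (y + t) ∂μ ≤ K * ∫⁻ y in Icc t (t + 1), g y := by
      have e1 : ∫⁻ y in Icc t (t + 1), g y = ∫⁻ y in Icc 0 1, g (y + t) := by
        rw [← lintegral_indicator measurableSet_Icc, ← lintegral_add_right_eq_self _ t,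
          ← lintegral_indicator measurableSet_Icc]
        refine lintegral_congr fun y => ?_
        simp only [indicator_apply, mem_Icc, le_add_iff_nonneg_left]
        congr 1
        rw [add_comm t 1, add_le_add_iff_right]
      have hgt : Measurable fun y => g (y + t) := hgm.comp (measurable_id.add_const t)
      rw [e1, ← lintegral_const_mul _ hgt,
        ← lintegral_indicator measurableSet_Icc, h.lintegral_weightedMeasure
          (hgt.indicator measurableSet_Icc),
        ← lintegral_indicator measurableSet_Icc]
      refine lintegral_mono fun y => ?_
      simp only [indicator_apply]
      split_ifs with hy
      · gcongr
        exact ENNReal.ofReal_le_ofReal (hle _ _ hy.2 (by linarith [hy.1]))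
      · simp
    rw [mul_comm, ← div_eq_mul_inv]
    exact ENNReal.div_le_of_le_mul' (h8.trans h9)
  -- For `y ∈ [m, m + 2)` and `t ∈ [n, n + 1)` the point `y - t` lies within `3` to the right of `m
  -- - n - 1`. This is also the source of the shift by `-1` below.
  obtain ⟨C, hC, hle⟩ := h.exists_le_mul 3
  set A' : Set ℤ := {n : ℤ | ∃ t ∈ A, n ≤ t ∧ t < n + 1} with hA'
  have hkey : ∀ n ∈ A', ∀ F : Finset ℤ, (∀ m ∈ F, m ∈ A') →
      ∑ m ∈ F, ρ ((m - n : ℤ) - 1) ≤ (c0⁻¹ * (ENNReal.ofReal C * (C0 + C0))).toReal := by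
    rintro n ⟨t, htA, hnt, htn⟩ F hF
    have hone : ∀ m ∈ F, ENNReal.ofReal (ρ ((m - n : ℤ) - 1)) * c0 ≤
        ENNReal.ofReal C * ∫⁻ y in Ico (m : ℝ) (m + 2), ENNReal.ofReal (ρ (y - t)) * g y := by
      intro m hm
      obtain ⟨s, hsA, hms, hsm⟩ := hF m hm
      calc ENNReal.ofReal (ρ ((m - n : ℤ) - 1)) * c0
          ≤ ENNReal.ofReal (ρ ((m - n : ℤ) - 1)) * ∫⁻ y in Ico (m : ℝ) (m + 2), g y := by
            refine mul_le_mul_right ((hc0A s hsA).trans (lintegral_mono_set ?_)) _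
            intro y hy
            exact ⟨hms.trans hy.1, by linarith [hy.2]⟩
        _ = ∫⁻ y in Ico (m : ℝ) (m + 2), ENNReal.ofReal (ρ ((m - n : ℤ) - 1)) * g y :=
            (lintegral_const_mul _ hgm).symm
        _ ≤ ∫⁻ y in Ico (m : ℝ) (m + 2),
              ENNReal.ofReal C * (ENNReal.ofReal (ρ (y - t)) * g y) := by
            refine setLIntegral_mono' measurableSet_Ico fun y hy => ?_
            rw [← mul_assoc, ← ENNReal.ofReal_mul hC.le]
            gcongr
            apply hle
            · push_cast; linarith [hy.1]
            · push_cast; linarith [hy.2]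
        _ = _ := lintegral_const_mul' _ _ ENNReal.ofReal_ne_top
    -- The intervals `[m, m + 2)` overlap for consecutive `m`. Halving them gives two disjoint
    -- families, each of total at most `C0`.
    have hsplit : ∀ m : ℤ, ∫⁻ y in Ico (m : ℝ) (m + 2), ENNReal.ofReal (ρ (y - t)) * g y ≤
        (∫⁻ y in Ico (m : ℝ) (m + 1), ENNReal.ofReal (ρ (y - t)) * g y) +
        ∫⁻ y in Ico ((m : ℝ) + 1) (m + 2), ENNReal.ofReal (ρ (y - t)) * g y := by
      intro m
      rw [← Ico_union_Ico_eq_Ico (b := (m : ℝ) + 1) (by linarith) (by linarith)]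
      exact lintegral_union_le _ _ _
    have htot : ∀ a : ℝ, ∑ m ∈ F, ∫⁻ y in Ico ((m : ℝ) + a) (m + a + 1),
        ENNReal.ofReal (ρ (y - t)) * g y ≤ C0 := by
      intro a
      rw [← lintegral_biUnion_finset]
      · exact (setLIntegral_le_lintegral _ _).trans (hC0A t htA)
      · intro i _ j _ hij
        refine Set.disjoint_left.2 fun y hy hy' => hij ?_
        have h1 : (i : ℝ) < j + 1 := by linarith [hy.1, hy'.2]
        have h2 : (j : ℝ) < i + 1 := by linarith [hy.2, hy'.1]
        have h1' : i < j + 1 := by exact_mod_cast h1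
        have h2' : j < i + 1 := by exact_mod_cast h2
        omega
      · exact fun m _ => measurableSet_Ico
    have hsum : (∑ m ∈ F, ENNReal.ofReal (ρ ((m - n : ℤ) - 1))) * c0 ≤
        ENNReal.ofReal C * (C0 + C0) := by
      rw [Finset.sum_mul]
      refine (Finset.sum_le_sum hone).trans ?_
      rw [← Finset.mul_sum]
      refine mul_le_mul_right ((Finset.sum_le_sum fun m _ => hsplit m).trans ?_) _
      rw [Finset.sum_add_distrib]
      refine add_le_add ?_ ?_
      · simpa using htot 0
      · have := htot 1
        simpa only [add_assoc, one_add_one_eq_two] using this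
    rw [← ENNReal.ofReal_sum_of_nonneg fun m _ => (h.pos _).le] at hsum
    have hfin : c0⁻¹ * (ENNReal.ofReal C * (C0 + C0)) ≠ ∞ :=
      ENNReal.mul_ne_top (ENNReal.inv_ne_top.2 hc0)
        (ENNReal.mul_ne_top ENNReal.ofReal_ne_top (ENNReal.add_ne_top.2 ⟨hC0, hC0⟩))
    rw [← ENNReal.ofReal_le_iff_le_toReal hfin, mul_comm c0⁻¹, ← div_eq_mul_inv]
    -- Only `c0 ≠ 0` was recorded. If `c0 = ∞`, the finite bound forces the sum to vanish.
    by_cases hc0t : c0 = ∞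
    · have h0 := hsum
      rw [hc0t] at h0
      by_contra hcon
      have hne : ENNReal.ofReal (∑ m ∈ F, ρ ((m - n : ℤ) - 1)) ≠ 0 := by
        intro h1; rw [h1] at hcon; exact hcon zero_le
      rw [ENNReal.mul_top hne] at h0
      exact (ENNReal.mul_ne_top ENNReal.ofReal_ne_top (ENNReal.add_ne_top.2 ⟨hC0, hC0⟩))
        (top_le_iff.1 h0)
    · exact (ENNReal.le_div_iff_mul_le (Or.inl hc0) (Or.inl hc0t)).2 hsum
  have hsumm : Summable fun k : ℤ => ρ ((k : ℝ) - 1) := by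
    refine summable_of_sum_sub_le (fun k => (h.pos _).le) (fun j hj => ?_) hδ
      hdens.frequently hkey
    obtain ⟨c, -, hc⟩ := h.exists_le_mul j
    refine ⟨c, fun k => hc _ _ ?_ ?_⟩
    · have : (0 : ℝ) ≤ j := by exact_mod_cast hj
      push_cast; linarith
    · push_cast; linarith
  have := (Equiv.addRight (1 : ℤ)).summable_iff.2 hsumm
  simpa [Function.comp_def] using this

end IsAdmissibleWeight

/-! ### A nonzero periodic point forces integrability. -/

namespace IsAdmissibleWeight

variable {ρ : ℝ → ℝ} {p : ℝ≥0∞} [Fact (1 ≤ p)]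

/-- By periodicity `|f|^p` has the same Lebesgue mass `H > 0` on every cell of length `a`, while `ρ
≥ ρ (k a) / C` on the `k`-th cell. The finite norm of `f` thus dominates a positive multiple of `∑ ρ
(k a)`. -/
theorem integrable_of_isPeriodicPoint (h : IsAdmissibleWeight ρ) (hp : p ≠ ∞)
    {f : WeightedLp p ρ} (hf : f ≠ 0) (hper : (h.translationSemigroup hp).IsPeriodicPoint f) :
    Integrable ρ volume := by
  have hp0 : p ≠ 0 := (zero_lt_one.trans_le (Fact.out : (1 : ℝ≥0∞) ≤ p)).ne'
  have hpr : 0 < p.toReal := ENNReal.toReal_pos hp0 hp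
  obtain ⟨t, ht, hft⟩ := hper
  set a : ℝ := (t : ℝ) with ha
  have ha0 : 0 < a := ht
  set g : ℝ → ℝ≥0∞ := fun y => ‖f y‖ₑ ^ p.toReal with hg
  have hgm : Measurable g := (Lp.stronglyMeasurable f).measurable.enorm.pow_const _
  have hga : ∀ᵐ y, g (y + a) = g y := by
    have h1 := h.translate_ae_eq hp t f
    have h2 : h.translate hp t f = f := hft
    rw [h2] at h1
    rw [Filter.EventuallyEq, h.ae_weightedMeasure] at h1
    filter_upwards [h1] with y hy
    simp only [hg]
    rw [hy]
  have hstep : ∀ k : ℤ, ∫⁻ y in Ioc (((k + 1 : ℤ) : ℝ) * a) (((k + 1 : ℤ) + 1) * a), g y =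
      ∫⁻ y in Ioc (k * a) ((k + 1) * a), g y := by
    intro k
    rw [← lintegral_indicator measurableSet_Ioc, ← lintegral_add_right_eq_self _ a,
      ← lintegral_indicator measurableSet_Ioc]
    refine lintegral_congr_ae ?_
    filter_upwards [hga] with y hy
    have : y + a ∈ Ioc (((k + 1 : ℤ) : ℝ) * a) (((k + 1 : ℤ) + 1) * a) ↔
        y ∈ Ioc (k * a) ((k + 1) * a) := by
      simp only [mem_Ioc]
      push_cast
      constructor <;> rintro ⟨h1, h2⟩ <;> constructor <;> linarith
    simp only [indicator_apply, this, hy]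
  set H := ∫⁻ y in Ioc (((0 : ℤ) : ℝ) * a) (((0 : ℤ) + 1) * a), g y with hH
  have hconst : ∀ k : ℤ, ∫⁻ y in Ioc (k * a) ((k + 1) * a), g y = H := by
    intro k
    induction k using Int.induction_on with
    | zero => rfl
    | succ i ih => rw [hstep, ih]
    | pred i ih =>
      rw [← ih, ← hstep (-i - 1)]
      simp only [sub_add_cancel]
  have hH0 : H ≠ 0 := by
    intro h0
    have h1 : ∫⁻ y, g y = 0 := by
      rw [lintegral_eq_tsum_Ioc volume ha0]
      simp [hconst, h0]
    rw [lintegral_eq_zero_iff hgm, ← h.ae_weightedMeasure] at h1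
    apply hf
    rw [Lp.eq_zero_iff_ae_eq_zero]
    filter_upwards [h1] with y hy
    simpa [hg, hpr, hpr.not_gt] using hy
  obtain ⟨C, hC, hle⟩ := h.exists_le_mul a
  have hfin : ∫⁻ y, ENNReal.ofReal (ρ y) * g y ≠ ∞ := by
    rw [← h.lintegral_weightedMeasure hgm]
    exact ((eLpNorm_lt_top_iff_lintegral_rpow_enorm_lt_top hp0 hp).1 (Lp.eLpNorm_lt_top f)).ne
  rw [lintegral_eq_tsum_Ioc volume ha0] at hfin
  have hle' : H * ENNReal.ofReal C⁻¹ * ∑' k : ℤ, ENNReal.ofReal (ρ (k * a)) ≤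
      ∑' k : ℤ, ∫⁻ y in Ioc (k * a) ((k + 1) * a), ENNReal.ofReal (ρ y) * g y := by
    rw [← ENNReal.tsum_mul_left]
    refine ENNReal.tsum_le_tsum fun k => ?_
    rw [← hconst k, mul_assoc, ← ENNReal.ofReal_mul (by positivity), mul_comm,
      ← lintegral_const_mul _ hgm]
    refine setLIntegral_mono' measurableSet_Ioc fun y hy => ?_
    gcongr
    rw [inv_mul_le_iff₀ hC]
    exact hle _ _ hy.1.le (by linarith [hy.2])
  refine (h.integrable_iff_summable ha0).2
    (summable_of_tsum_ofReal_ne_top (fun k => (h.pos _).le) fun htop => ?_)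
  rw [htop, ENNReal.mul_top (mul_ne_zero hH0 (by simpa using hC))] at hle'
  exact hfin (top_le_iff.1 hle')

theorem nontrivial_weightedLp (h : IsAdmissibleWeight ρ) (hp : p ≠ ∞) :
    Nontrivial (WeightedLp p ρ) := by
  have := h.isLocallyFiniteMeasure
  have hp0 : p ≠ 0 := (zero_lt_one.trans_le (Fact.out : (1 : ℝ≥0∞) ≤ p)).ne'
  have hIfin : weightedMeasure ρ (Icc (0 : ℝ) 1) ≠ ∞ := isCompact_Icc.measure_lt_top.ne
  have hIpos : weightedMeasure ρ (Icc (0 : ℝ) 1) ≠ 0 := by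
    have : ¬ (∀ᵐ y ∂weightedMeasure ρ, y ∉ Icc (0 : ℝ) 1) := by
      rw [h.ae_weightedMeasure, ← measure_eq_zero_iff_ae_notMem]
      simp
    rwa [← measure_eq_zero_iff_ae_notMem] at this
  refine ⟨indicatorConstLp p measurableSet_Icc hIfin (1 : ℝ), 0, fun h0 => ?_⟩
  have := norm_indicatorConstLp (p := p) (hs := measurableSet_Icc) (hμs := hIfin)
    (c := (1 : ℝ)) hp0 hp
  rw [h0, norm_zero, norm_one, one_mul] at this
  exact (Real.rpow_pos_of_pos (ENNReal.toReal_pos hIpos hIfin) (1 / p.toReal)).ne this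

end IsAdmissibleWeight

/-! ### Two-sided trajectories and periodic points from the Criterion. -/

section Pettis

variable {X : Type*} [NormedAddCommGroup X] [NormedSpace ℝ X]

/-- The second half is reflected onto the negative axis and the weak integrals are added; the halves
share only the null set `{0}`. -/
theorem PettisIntegrable.glue {f g : ℝ → X} (hf : PettisIntegrable f (volume.restrict (Ici 0)))
    (hg : PettisIntegrable g (volume.restrict (Ici 0))) :
    PettisIntegrable (fun t => if 0 ≤ t then f t else g (-t)) volume := by
  have mp : MeasurePreserving (fun t : ℝ => -t) volume volume := Measure.measurePreserving_neg volume
  have me : MeasurableEmbedding (fun t : ℝ => -t) := (MeasurableEquiv.neg ℝ).measurableEmbedding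
  have hpre : (fun t : ℝ => -t) ⁻¹' (Ioi 0) = Iio 0 := by ext; simp
  have e1 : ∀ φ : X →L[ℝ] ℝ, EqOn (fun t => φ (f t))
      (fun t => φ (if 0 ≤ t then f t else g (-t))) (Ici 0) := fun φ t ht => by
    have ht' : (0 : ℝ) ≤ t := ht
    simp [ht']
  have e2 : ∀ φ : X →L[ℝ] ℝ, EqOn (fun t => φ (g (-t)))
      (fun t => φ (if 0 ≤ t then f t else g (-t))) (Iio 0) := fun φ t ht => by
    have ht' : ¬ (0 : ℝ) ≤ t := not_le.2 ht
    simp [ht']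
  have hi1 : ∀ φ : X →L[ℝ] ℝ,
      IntegrableOn (fun t => φ (if 0 ≤ t then f t else g (-t))) (Ici 0) := fun φ =>
    IntegrableOn.congr_fun (hf.1 φ) (e1 φ) measurableSet_Ici
  have hi2 : ∀ φ : X →L[ℝ] ℝ,
      IntegrableOn (fun t => φ (if 0 ≤ t then f t else g (-t))) (Iio 0) := fun φ => by
    refine IntegrableOn.congr_fun ?_ (e2 φ) measurableSet_Iio
    have h1 : IntegrableOn (fun t => φ (g t)) (Ioi 0) :=
      IntegrableOn.mono_set (hg.1 φ) Ioi_subset_Ici_self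
    have := (mp.integrableOn_comp_preimage me).2 h1
    rwa [hpre] at this
  have hi : ∀ φ : X →L[ℝ] ℝ, Integrable (fun t => φ (if 0 ≤ t then f t else g (-t))) := fun φ => by
    rw [← integrableOn_univ, ← Iio_union_Ici (a := (0 : ℝ))]
    exact (hi2 φ).union (hi1 φ)
  refine ⟨hi, fun E hE => ?_⟩
  obtain ⟨u, hu⟩ := hf.2 E hE
  obtain ⟨v, hv⟩ := hg.2 ((fun t : ℝ => -t) ⁻¹' E) (me.measurable hE)
  refine ⟨u + v, fun φ => ?_⟩
  rw [map_add, hu, hv, Measure.restrict_restrict hE, Measure.restrict_restrict (me.measurable hE),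
    ← integral_inter_add_sdiff (s := E) (t := Ici 0) measurableSet_Ici (hi φ).integrableOn]
  congr 1
  · exact setIntegral_congr_fun (hE.inter measurableSet_Ici) fun t ht => e1 φ ht.2
  · have h1 : E \ Ici 0 = (fun t : ℝ => -t) ⁻¹' ((fun t : ℝ => -t) ⁻¹' E ∩ Ioi 0) := by
      ext; simp
    have h2 : ((fun t : ℝ => -t) ⁻¹' E ∩ Ici 0 : Set ℝ) =ᵐ[volume]
        ((fun t : ℝ => -t) ⁻¹' E ∩ Ioi 0 : Set ℝ) :=
      (ae_eq_refl _).inter Ioi_ae_eq_Ici.symm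
    rw [setIntegral_congr_set h2, ← mp.setIntegral_preimage_emb me, ← h1]
    exact setIntegral_congr_fun (hE.diff measurableSet_Ici) fun t ht =>
      e2 φ (mem_Iio.2 (not_le.1 ht.2))

end Pettis

namespace C0Semigroup

variable {X : Type*} [NormedAddCommGroup X] [NormedSpace ℝ X]

/-- A semigroup satisfying the Frequent Hypercyclicity Criterion on a nontrivial space has a
nonzero periodic point: a weak integral of a two-sided trajectory over a periodic set. -/
theorem FrequentHypercyclicityCriterion.exists_isPeriodicPoint [Nontrivial X] {T : C0Semigroup X}
    (hT : T.FrequentHypercyclicityCriterion) : ∃ x ≠ 0, T.IsPeriodicPoint x := by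
  obtain ⟨X₀, S, hdense, hTS, hTS', hPT, hPS⟩ := hT
  obtain ⟨y, hyX, hy0⟩ : ∃ y ∈ X₀, y ≠ 0 := by
    obtain ⟨z, hz⟩ := exists_ne (0 : X)
    obtain ⟨y, hy⟩ := hdense.exists_mem_open isOpen_ne ⟨z, hz⟩
    exact ⟨y, hy⟩
  set x : X₀ := ⟨y, hyX⟩ with hx
  set F : ℝ → X := fun t => if 0 ≤ t then T.op t.toNNReal x else S (-t).toNNReal x with hF
  have hFP : PettisIntegrable F volume := (hPT x).glue (hPS x)
  -- The cases are: stay on the forward half (semigroup law), cross zero (`T_a = T_{t+a} T_{-t}`,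
  -- and `T_{-t}` undoes `S_{-t}`), or stay on the backward half (`T_a S_r = S_{r-a}`).
  have hTF : ∀ (a : ℝ≥0) (t : ℝ), 0 < a → T.op a (F t) = F (t + a) := by
    intro a t ha
    have ha' : (0 : ℝ) < a := ha
    simp only [hF]
    by_cases h0 : 0 ≤ t
    · rw [if_pos h0, if_pos (by positivity), Real.toNNReal_add h0 ha'.le, Real.toNNReal_coe,
        add_comm, T.op_add]
      rfl
    · have h0' : 0 < -t := by linarith
      rw [if_neg h0]
      set r := (-t).toNNReal with hr
      have hrt : (r : ℝ) = -t := Real.coe_toNNReal _ h0'.le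
      have hr0 : 0 < r := by rw [← NNReal.coe_pos, hrt]; exact h0'
      by_cases h1 : 0 ≤ t + a
      · rw [if_pos h1]
        have : a = (t + a).toNNReal + r := by
          rw [← NNReal.coe_inj, NNReal.coe_add, Real.coe_toNNReal _ h1, hrt]; ring
        conv_lhs => rw [this, T.op_add, ContinuousLinearMap.comp_apply, hTS x r hr0]
      · rw [if_neg h1, hTS' x a r ha (by rw [← NNReal.coe_lt_coe, hrt]; linarith)]
        congr 3
        rw [← NNReal.coe_inj, NNReal.coe_sub (by rw [← NNReal.coe_le_coe, hrt]; linarith), hrt,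
          Real.coe_toNNReal _ (by linarith)]
        ring
  obtain ⟨φ, hφ⟩ : ∃ φ : X →L[ℝ] ℝ, 0 < φ y := by
    obtain ⟨φ, hφ⟩ := SeparatingDual.exists_ne_zero (R := ℝ) hy0
    rcases hφ.lt_or_gt with h | h
    · exact ⟨-φ, by simpa using h⟩
    · exact ⟨φ, h⟩
  obtain ⟨b, hb, hFb⟩ : ∃ b > 0, ∀ t ∈ Ico 0 b, φ y / 2 ≤ φ (F t) := by
    have h1 : Tendsto (fun t : ℝ≥0 => φ (T.op t y)) (𝓝 0) (𝓝 (φ y)) :=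
      (φ.continuous.tendsto y).comp (T.tendsto_zero y)
    have h2 : Tendsto Real.toNNReal (𝓝 0) (𝓝 0) := by
      simpa using continuous_real_toNNReal.tendsto 0
    have h3 := (h1.comp h2).eventually_const_le (half_lt_self hφ)
    obtain ⟨b, hb, hball⟩ := Metric.eventually_nhds_iff.1 h3
    refine ⟨b, hb, fun t ht => ?_⟩
    have := hball (y := t) (by rw [Real.dist_eq, sub_zero, abs_of_nonneg ht.1]; exact ht.2)
    simpa [hF, ht.1] using this
  have hint : 0 < ∫ t in Ico 0 b, φ (F t) := by
    have h1 : ∫ t in Ico 0 b, φ y / 2 ≤ ∫ t in Ico 0 b, φ (F t) :=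
      setIntegral_mono_on (by simp) (hFP.1 φ).integrableOn measurableSet_Ico hFb
    refine lt_of_lt_of_le ?_ h1
    simp only [integral_const, measureReal_restrict_apply_univ, Real.volume_real_Ico, sub_zero,
      smul_eq_mul]
    have : 0 < max b 0 := lt_max_of_lt_left hb
    positivity
  -- This is the union of the intervals `[kn, kn + b)`, `k ∈ ℤ`. As `n` grows all but the one with
  -- `k = 0` escape to infinity, so by dominated convergence the weak integral over `P n` is
  -- eventually nonzero under `φ`.
  set P : ℕ → Set ℝ := fun n => {t : ℝ | Int.fract (t / n) * n < b} with hP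
  have hPm : ∀ n, MeasurableSet (P n) := fun n =>
    measurableSet_lt ((measurable_fract.comp (measurable_id.div_const _)).mul_const _)
      measurable_const
  have hlim : Tendsto (fun n : ℕ => ∫ t in P n, φ (F t)) atTop (𝓝 (∫ t in Ico 0 b, φ (F t))) := by
    simp_rw [← integral_indicator (hPm _)]
    rw [← integral_indicator measurableSet_Ico]
    refine tendsto_integral_of_dominated_convergence (fun t => ‖φ (F t)‖)
      (fun n => ((hFP.1 φ).indicator (hPm n)).aestronglyMeasurable) (hFP.1 φ).norm
      (fun n => ae_of_all _ fun t => norm_indicator_le_norm_self _ _)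
      (ae_of_all _ fun t => ?_)
    refine tendsto_const_nhds.congr' ?_
    filter_upwards [eventually_gt_atTop ⌈|t| + b⌉₊] with n hn
    have hn' : |t| + b < n := Nat.lt_of_ceil_lt hn
    have hn0 : (0 : ℝ) < n := by have := abs_nonneg t; linarith
    have hmem : t ∈ P n ↔ t ∈ Ico 0 b := by
      simp only [hP, mem_ofPred_eq, mem_Ico]
      rcases le_or_gt 0 t with h0 | h0
      · rw [abs_of_nonneg h0] at hn'
        have : Int.fract (t / n) = t / n := by
          rw [Int.fract_eq_self]
          exact ⟨by positivity, (div_lt_one hn0).2 (by linarith)⟩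
        rw [this, div_mul_cancel₀ _ hn0.ne']
        exact ⟨fun h => ⟨h0, h⟩, fun h => h.2⟩
      · rw [abs_of_neg h0] at hn'
        have : Int.fract (t / n) = t / n + 1 := by
          rw [← Int.fract_add_one, Int.fract_eq_self]
          have h1 : -1 < t / n := by rw [lt_div_iff₀ hn0]; linarith
          have h2 : t / n < 0 := div_neg_of_neg_of_pos h0 hn0
          exact ⟨by linarith, by linarith⟩
        rw [this, add_mul, div_mul_cancel₀ _ hn0.ne']
        exact ⟨fun h => absurd h (by linarith), fun h => absurd h.1 (by linarith)⟩
    simp only [indicator_apply, hmem]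
  obtain ⟨n, hn, hn0⟩ := ((hlim.eventually_const_lt hint).and (eventually_gt_atTop 0)).exists
  obtain ⟨w, hw⟩ := hFP.2 (P n) (hPm n)
  refine ⟨w, ?_, n, by exact_mod_cast hn0, ?_⟩
  · rintro rfl
    rw [← hw φ, map_zero] at hn
    exact lt_irrefl _ hn
  -- `T_n` shifts the trajectory by `n`, and `P n` is invariant under that shift; hence `T_n w = w`,
  -- tested on functionals.
  · refine (SeparatingDual.eq_iff_forall_dual_eq (R := ℝ)).2 fun ψ => ?_
    have h1 := hw (ψ.comp (T.op n))
    rw [ContinuousLinearMap.comp_apply] at h1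
    rw [h1, hw ψ]
    simp only [ContinuousLinearMap.comp_apply, hTF (n : ℝ≥0) _ (by exact_mod_cast hn0)]
    rw [← integral_indicator (hPm n), ← integral_indicator (hPm n),
      ← integral_add_right_eq_self ((P n).indicator fun t => ψ (F t)) (n : ℝ)]
    refine integral_congr_ae (ae_of_all _ fun t => ?_)
    have hn0' : (n : ℝ) ≠ 0 := by positivity
    have hmem : t + n ∈ P n ↔ t ∈ P n := by
      simp only [hP, mem_ofPred_eq, add_div, div_self hn0', Int.fract_add_one]
    simp only [indicator_apply, hmem, NNReal.coe_natCast]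

end C0Semigroup

/-! ### A sufficient condition for Pettis integrability. -/

section Pettis

variable {X : Type*} [NormedAddCommGroup X] [NormedSpace ℝ X]

theorem PettisIntegrable.comp_equiv {α : Type*} [MeasurableSpace α] {μ : Measure α} {f : α → X}
    (hf : PettisIntegrable f μ) (e : α ≃ᵐ α) (he : MeasurePreserving e μ μ) :
    PettisIntegrable (fun a => f (e a)) μ := by
  refine ⟨fun φ => (he.integrable_comp_emb e.measurableEmbedding).2 (hf.1 φ), fun E hE => ?_⟩
  obtain ⟨x, hx⟩ := hf.2 (e.symm ⁻¹' E) (e.symm.measurable hE)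
  refine ⟨x, fun φ => ?_⟩
  rw [hx, ← he.setIntegral_preimage_emb e.measurableEmbedding, ← preimage_comp]
  simp

theorem PettisIntegrable.restrict {α : Type*} [MeasurableSpace α] {μ : Measure α} {f : α → X}
    (hf : PettisIntegrable f μ) {s : Set α} (hs : MeasurableSet s) :
    PettisIntegrable f (μ.restrict s) := by
  refine ⟨fun φ => (hf.1 φ).restrict, fun E hE => ?_⟩
  obtain ⟨x, hx⟩ := hf.2 (E ∩ s) (hE.inter hs)
  exact ⟨x, fun φ => by rw [hx, Measure.restrict_restrict hE]⟩

theorem PettisIntegrable.congr_ae {α : Type*} [MeasurableSpace α] {μ : Measure α} {f g : α → X}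
    (hf : PettisIntegrable f μ) (hfg : f =ᵐ[μ] g) : PettisIntegrable g μ := by
  have h : ∀ φ : X →L[ℝ] ℝ, (fun a => φ (f a)) =ᵐ[μ] fun a => φ (g a) := fun φ => by
    filter_upwards [hfg] with a ha
    rw [ha]
  refine ⟨fun φ => (hf.1 φ).congr (h φ), fun E hE => ?_⟩
  obtain ⟨x, hx⟩ := hf.2 E hE
  exact ⟨x, fun φ => by rw [hx]; exact integral_congr_ae (ae_restrict_of_ae (h φ))⟩

/-- A continuous function whose signed sums along translates of `ℤ` are uniformly small off
finite sets is Pettis integrable. -/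
theorem PettisIntegrable.of_small_sums [CompleteSpace X] {F : ℝ → X} (hF : Continuous F)
    (h : ∀ ε > 0, ∃ S : Finset ℤ, ∀ K : Finset ℤ, Disjoint K S → ∀ e : ℤ → ℝ, (∀ k, |e k| ≤ 1) →
      ∀ s ∈ Ioc (0 : ℝ) 1, ‖∑ k ∈ K, e k • F (s + k)‖ ≤ ε) :
    PettisIntegrable F volume := by
  have hint : ∀ e : ℝ → ℝ, Measurable e → (∀ t, |e t| ≤ 1) → ∀ a b : ℝ,
      IntervalIntegrable (fun t => e t • F t) volume a b := fun e hem he a b => by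
    have h1 := hF.intervalIntegrable (μ := volume) a b
    exact ⟨h1.1.bdd_smul 1 hem.aestronglyMeasurable (ae_of_all _ he),
      h1.2.bdd_smul 1 hem.aestronglyMeasurable (ae_of_all _ he)⟩
  -- Moving all cells to `[0, 1]` turns a finite sum of cell integrals into one integral of the
  -- signed sums that the hypothesis controls.
  have hsum : ∀ e : ℝ → ℝ, Measurable e → (∀ t, |e t| ≤ 1) →
      Summable fun k : ℤ => ∫ t in (k : ℝ)..(k + 1), e t • F t := by
    intro e hem he
    rw [summable_iff_vanishing_norm]
    intro ε hε
    obtain ⟨S, hS⟩ := h (ε / 2) (half_pos hε)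
    refine ⟨S, fun K hK => ?_⟩
    have h1 : ∀ k : ℤ, ∫ t in (k : ℝ)..(k + 1), e t • F t =
        ∫ s in (0 : ℝ)..1, e (s + k) • F (s + k) := fun k => by
      rw [intervalIntegral.integral_comp_add_right (fun t => e t • F t) (k : ℝ), zero_add,
        add_comm (1 : ℝ)]
    simp_rw [h1]
    rw [← intervalIntegral.integral_finsetSum]
    · refine (intervalIntegral.norm_integral_le_of_norm_le_const (C := ε / 2)
        fun s hs => ?_).trans_lt ?_
      · rw [uIoc_of_le zero_le_one] at hs
        exact hS K hK (fun k => e (s + k)) (fun k => he _) s hs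
      · rw [sub_zero, abs_one, mul_one]
        exact half_lt_self hε
    · intro k _
      have := (hint e hem he (0 + k) (1 + k)).comp_add_right (k : ℝ)
      simpa using this
  have hφv : ∀ (φ : X →L[ℝ] ℝ) (e : ℝ → ℝ), Measurable e → (∀ t, |e t| ≤ 1) → ∀ k : ℤ,
      φ (∫ t in (k : ℝ)..(k + 1), e t • F t) =
        ∫ t in Ioc (k : ℝ) (k + 1), e t * φ (F t) := fun φ e hem he k => by
    rw [← φ.intervalIntegral_comp_comm (hint e hem he _ _),
      intervalIntegral.integral_of_le (by linarith)]
    simp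
  have hU : ⋃ k : ℤ, Ioc (k : ℝ) (k + 1) = univ := iUnion_Ioc_intCast ℝ
  have hdisj : Pairwise (Function.onFun Disjoint fun k : ℤ => Ioc (k : ℝ) (k + 1)) :=
    pairwise_disjoint_Ioc_intCast ℝ
  have hI : ∀ φ : X →L[ℝ] ℝ, Integrable (fun t => φ (F t)) volume := by
    intro φ
    have hφF : Continuous fun t => φ (F t) := φ.continuous.comp hF
    -- Taking `e` to be the sign of `φ ∘ F` converts summability of the vectors into that of `∫ |φ ∘
    -- F|` over the cells.
    set e : ℝ → ℝ := fun t => if 0 ≤ φ (F t) then 1 else -1 with he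
    have hem : Measurable e :=
      Measurable.ite (measurableSet_le measurable_const hφF.measurable) measurable_const
        measurable_const
    have he1 : ∀ t, |e t| ≤ 1 := fun t => by
      simp only [he]; split_ifs <;> simp
    rw [← integrableOn_univ, ← hU]
    refine integrableOn_iUnion_of_summable_integral_norm
      (fun k => (hφF.integrableOn_Icc).mono_set Ioc_subset_Icc_self) ?_
    have h1 := φ.summable (hsum e hem he1)
    refine h1.congr fun k => ?_
    rw [hφv φ e hem he1]
    refine setIntegral_congr_fun measurableSet_Ioc fun t _ => ?_
    simp only [he, Real.norm_eq_abs]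
    split_ifs with h0
    · rw [one_mul, abs_of_nonneg h0]
    · rw [neg_one_mul, abs_of_neg (not_le.1 h0)]
  refine ⟨hI, fun E hE => ?_⟩
  -- With this `e`, the sum of the cell integrals is the weak integral over `E`.
  set e : ℝ → ℝ := E.indicator fun _ => 1 with he
  have hem : Measurable e := measurable_const.indicator hE
  have he1 : ∀ t, |e t| ≤ 1 := fun t => by
    by_cases ht : t ∈ E <;> simp [he, ht]
  refine ⟨∑' k : ℤ, ∫ t in (k : ℝ)..(k + 1), e t • F t, fun φ => ?_⟩
  have heφ : (fun t => e t * φ (F t)) = E.indicator fun t => φ (F t) := by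
    ext t
    by_cases ht : t ∈ E <;> simp [he, ht]
  rw [φ.map_tsum (hsum e hem he1), ← integral_indicator hE]
  simp_rw [hφv φ e hem he1, heφ]
  have h2 := hasSum_integral_iUnion (μ := volume) (f := E.indicator fun t => φ (F t))
    (fun k : ℤ => measurableSet_Ioc (a := (k : ℝ)) (b := k + 1)) hdisj
    ((hI φ).indicator hE).integrableOn
  rw [h2.tsum_eq, hU, Measure.restrict_univ]

end Pettis

/-! ### Tail estimates for a finite weighted measure, and the Criterion. -/

/-- Limits how many integer translates of a function supported in `[-N, N]` overlap at one point. -/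
theorem card_filter_abs_add_lt_le (K : Finset ℤ) (z : ℝ) (N : ℕ) :
    (K.filter fun k : ℤ => |z + k| < N).card ≤ 2 * N + 1 := by
  have hsub : (K.filter fun k : ℤ => |z + k| < N) ⊆ Finset.Icc (⌊-z⌋ + 1 - N) (⌊-z⌋ + N + 1) := by
    intro k hk
    have h1 := abs_lt.1 (Finset.mem_filter.1 hk).2
    have h2 := Int.floor_le (-z)
    have h3 := Int.lt_floor_add_one (-z)
    rw [Finset.mem_Icc]
    constructor
    · have : ((⌊-z⌋ - N : ℤ) : ℝ) < k := by push_cast; linarith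
      have : ⌊-z⌋ - N < k := by exact_mod_cast this
      omega
    · have : (k : ℝ) < ((⌊-z⌋ + 1 + N : ℤ) : ℝ) := by push_cast; linarith
      have : k < ⌊-z⌋ + 1 + N := by exact_mod_cast this
      omega
  refine (Finset.card_le_card hsub).trans ?_
  rw [Int.card_Icc]
  omega

theorem CompactlySupportedContinuousMap.exists_bounds (g : CompactlySupportedContinuousMap ℝ ℝ) :
    ∃ (B : ℝ) (N : ℕ), 0 ≤ B ∧ (∀ y, |g y| ≤ B) ∧ ∀ y, (N : ℝ) ≤ |y| → g y = 0 := by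
  obtain ⟨R, -, hR⟩ := g.hasCompactSupport.exists_pos_le_norm
  obtain ⟨B, hB⟩ := g.continuous.bounded_above_of_compact_support g.hasCompactSupport
  exact ⟨B, ⌈R⌉₊, (norm_nonneg _).trans (hB 0), hB, fun y hy => hR y ((Nat.le_ceil R).trans hy)⟩

/-- The norm in `L_p^ρ(ℝ)` of the indicator function of `{y | R ≤ |y|}`. -/
noncomputable def tailNorm (ρ : ℝ → ℝ) (p : ℝ≥0∞) (R : ℝ) : ℝ :=
  (weightedMeasure ρ {y | R ≤ |y|} ^ p.toReal⁻¹).toReal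

theorem tailNorm_nonneg (ρ : ℝ → ℝ) (p : ℝ≥0∞) (R : ℝ) : 0 ≤ tailNorm ρ p R :=
  ENNReal.toReal_nonneg

theorem measurableSet_le_abs (R : ℝ) : MeasurableSet {y : ℝ | R ≤ |y|} :=
  measurableSet_le measurable_const continuous_abs.measurable

section Tail

variable {ρ : ℝ → ℝ} {p : ℝ≥0∞} [IsFiniteMeasure (weightedMeasure ρ)]

theorem tailNorm_antitone : Antitone (tailNorm ρ p) := by
  intro R R' hR
  refine ENNReal.toReal_mono (ENNReal.rpow_ne_top_of_nonneg (by positivity) (measure_ne_top _ _)) ?_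
  gcongr

/-- The bound depends on the supremum and on the distance of the support from the origin, not on the
number of bumps; sums of many translates are therefore estimated as single functions. -/
theorem norm_toLp_le_tailNorm [Fact (1 ≤ p)] {f : ℝ → ℝ} (hf : MemLp f p (weightedMeasure ρ))
    {B R : ℝ} (hB : 0 ≤ B) (hfB : ∀ y, |f y| ≤ B) (hfR : ∀ y, |y| < R → f y = 0) :
    ‖hf.toLp f‖ ≤ B * tailNorm ρ p R := by
  have h1 : f = {y | R ≤ |y|}.indicator f := by
    ext y
    rw [indicator_apply]
    split_ifs with h
    · rfl
    · exact hfR y (not_le.1 h)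
  have h2 : eLpNorm f p (weightedMeasure ρ) ≤
      weightedMeasure ρ {y | R ≤ |y|} ^ p.toReal⁻¹ * ENNReal.ofReal B := by
    rw [h1, eLpNorm_indicator_eq_eLpNorm_restrict (measurableSet_le_abs R)]
    have := eLpNorm_le_of_ae_bound (p := p) (f := f) (C := B)
      (μ := (weightedMeasure ρ).restrict {y | R ≤ |y|}) (ae_of_all _ hfB)
    rwa [Measure.restrict_apply_univ] at this
  rw [Lp.norm_toLp]
  refine (ENNReal.toReal_mono (ENNReal.mul_ne_top (ENNReal.rpow_ne_top_of_nonneg (by positivity)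
    (measure_ne_top _ _)) ENNReal.ofReal_ne_top) h2).trans (le_of_eq ?_)
  rw [ENNReal.toReal_mul, ENNReal.toReal_ofReal hB, mul_comm, tailNorm]

theorem tendsto_tailNorm [Fact (1 ≤ p)] (hp : p ≠ ∞) :
    Tendsto (tailNorm ρ p) atTop (𝓝 0) := by
  have hp0 : p ≠ 0 := (zero_lt_one.trans_le (Fact.out : (1 : ℝ≥0∞) ≤ p)).ne'
  have hpr : 0 < p.toReal⁻¹ := inv_pos.2 (ENNReal.toReal_pos hp0 hp)
  have h1 : Tendsto (weightedMeasure ρ ∘ fun R : ℝ => {y : ℝ | R ≤ |y|}) atTop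
      (𝓝 (weightedMeasure ρ (⋂ R : ℝ, {y : ℝ | R ≤ |y|}))) :=
    tendsto_measure_iInter_atTop (fun R => (measurableSet_le_abs R).nullMeasurableSet)
      (fun R R' hR y hy => hR.trans hy) ⟨0, measure_ne_top _ _⟩
  have h2 : (⋂ R : ℝ, {y : ℝ | R ≤ |y|}) = ∅ := by
    refine eq_empty_of_forall_notMem fun y hy => ?_
    have := mem_iInter.1 hy (|y| + 1)
    have h3 : |y| + 1 ≤ |y| := this
    linarith
  rw [h2, measure_empty] at h1
  have h3 := (ENNReal.continuous_rpow_const (y := p.toReal⁻¹)).tendsto 0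
  rw [ENNReal.zero_rpow_of_pos hpr] at h3
  have h4 := (ENNReal.tendsto_toReal ENNReal.zero_ne_top).comp (h3.comp h1)
  rwa [ENNReal.toReal_zero] at h4

theorem memLp_comp_add (g : CompactlySupportedContinuousMap ℝ ℝ) (t : ℝ) :
    MemLp (fun y => g (y + t)) p (weightedMeasure ρ) := by
  obtain ⟨B, N, -, hB, -⟩ := g.exists_bounds
  exact MemLp.of_bound (by fun_prop) B (ae_of_all _ fun y => hB _)

/-- The class of `y ↦ g (y + t)` in `L_p^ρ(ℝ)`. -/
noncomputable def shiftLp (ρ : ℝ → ℝ) (p : ℝ≥0∞) [IsFiniteMeasure (weightedMeasure ρ)]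
    (g : CompactlySupportedContinuousMap ℝ ℝ) (t : ℝ) : WeightedLp p ρ :=
  (memLp_comp_add g t).toLp fun y => g (y + t)

theorem exists_shiftLp_near (hp : p ≠ ∞) [IsLocallyFiniteMeasure (weightedMeasure ρ)]
    (f : WeightedLp p ρ) {ε : ℝ} (hε : 0 < ε) :
    ∃ g : CompactlySupportedContinuousMap ℝ ℝ, ‖f - shiftLp ρ p g 0‖ < ε := by
  obtain ⟨g, hgs, hfg, hgc, hgm⟩ := (Lp.memLp f).exists_hasCompactSupport_eLpNorm_sub_le hp
    (ε := ENNReal.ofReal (ε / 2)) (by simpa using hε)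
  refine ⟨⟨⟨g, hgc⟩, hgs⟩, ?_⟩
  have h1 : ⇑(f - shiftLp ρ p ⟨⟨g, hgc⟩, hgs⟩ 0) =ᵐ[weightedMeasure ρ] ⇑f - g := by
    filter_upwards [Lp.coeFn_sub f (shiftLp ρ p ⟨⟨g, hgc⟩, hgs⟩ 0),
      (memLp_comp_add ⟨⟨g, hgc⟩, hgs⟩ 0).coeFn_toLp (p := p) (μ := weightedMeasure ρ)] with y h2 h3
    rw [h2, Pi.sub_apply, shiftLp, h3, Pi.sub_apply, add_zero]
    rfl
  rw [Lp.norm_def, eLpNorm_congr_ae h1]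
  refine lt_of_le_of_lt (ENNReal.toReal_mono ENNReal.ofReal_ne_top hfg) ?_
  rw [ENNReal.toReal_ofReal (by positivity)]
  exact half_lt_self hε

variable [Fact (1 ≤ p)]

theorem continuous_shiftLp (g : CompactlySupportedContinuousMap ℝ ℝ) :
    Continuous (shiftLp ρ p g) := by
  rw [Metric.continuous_iff]
  intro t ε hε
  have hτ : 0 < tailNorm ρ p 0 + 1 := by have := tailNorm_nonneg ρ p 0; positivity
  obtain ⟨δ, hδ, hg⟩ := Metric.uniformContinuous_iff.1
    (g.hasCompactSupport.uniformContinuous_of_continuous g.continuous)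
    (ε / (tailNorm ρ p 0 + 1)) (by positivity)
  refine ⟨δ, hδ, fun s hs => ?_⟩
  rw [dist_eq_norm, shiftLp, shiftLp, ← MemLp.toLp_sub]
  refine (norm_toLp_le_tailNorm (B := ε / (tailNorm ρ p 0 + 1)) (R := 0) _ (by positivity)
    (fun y => ?_) fun y hy => absurd hy (abs_nonneg y).not_gt).trans_lt ?_
  · refine (hg (a := y + s) (b := y + t) ?_).le
    rwa [dist_add_left]
  · rw [div_mul_eq_mul_div, div_lt_iff₀ hτ]
    nlinarith

/-- At each point at most `2N + 1` integer translates are nonzero, so signed sums are bounded by `B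
(2N + 1)`. If the indices avoid `[-(R + N), R + N]`, the sum vanishes on `(-R, R)` and its norm is a
tail. For `p > 1` the norms of the translates need not be summable, so termwise estimates would not
do. -/
theorem pettisIntegrable_shiftLp (hp : p ≠ ∞) (g : CompactlySupportedContinuousMap ℝ ℝ) :
    PettisIntegrable (shiftLp ρ p g) volume := by
  refine PettisIntegrable.of_small_sums (continuous_shiftLp g) fun ε hε => ?_
  obtain ⟨B, N, hB0, hB, hN⟩ := g.exists_bounds
  have hlim : Tendsto (fun R : ℕ => B * (2 * N + 1) * tailNorm ρ p R) atTop (𝓝 0) := by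
    simpa using ((tendsto_tailNorm hp).comp tendsto_natCast_atTop_atTop).const_mul
      (B * (2 * N + 1))
  obtain ⟨R, hR⟩ := (hlim.eventually_le_const hε).exists
  refine ⟨Finset.Icc (-(R + N : ℤ)) (R + N), fun K hK e he s hs => ?_⟩
  refine le_trans ?_ hR
  have hmem : MemLp (fun y => ∑ k ∈ K, e k * g (y + (s + k))) p (weightedMeasure ρ) :=
    memLp_finsetSum _ fun k _ => (memLp_comp_add g (s + k)).const_mul (e k)
  have hsum : ∑ k ∈ K, e k • shiftLp ρ p g (s + k) = hmem.toLp _ := by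
    apply Lp.ext
    have h1 : ∀ k ∈ K, ⇑(e k • shiftLp ρ p g (s + k)) =ᵐ[weightedMeasure ρ]
        fun y => e k * g (y + (s + k)) := fun k _ => by
      filter_upwards [Lp.coeFn_smul (e k) (shiftLp ρ p g (s + k)),
        (memLp_comp_add g (s + k)).coeFn_toLp (p := p) (μ := weightedMeasure ρ)] with y h2 h3
      rw [h2, Pi.smul_apply, shiftLp, h3, smul_eq_mul]
    have h2 : ∀ᵐ y ∂weightedMeasure ρ, ∀ k ∈ K, (e k • shiftLp ρ p g (s + k)) y =
        e k * g (y + (s + k)) := (Finset.eventually_all K).2 h1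
    filter_upwards [h2, Lp.coeFn_finsetSum K (fun k : ℤ => e k • shiftLp ρ p g (s + k)),
      hmem.coeFn_toLp] with y h3 h4 h5
    rw [h4, h5, Finset.sum_apply]
    exact Finset.sum_congr rfl h3
  rw [hsum]
  refine norm_toLp_le_tailNorm _ (by positivity) (fun y => ?_) fun y hy => ?_
  · have h1 : ∀ k ∈ K, |e k * g (y + (s + k))| ≤ if |y + s + k| < N then B else 0 := by
      intro k _
      rw [← add_assoc, abs_mul]
      split_ifs with h
      · exact (mul_le_of_le_one_left (abs_nonneg _) (he k)).trans (hB _)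
      · rw [hN _ (not_lt.1 h), abs_zero, mul_zero]
    refine (Finset.abs_sum_le_sum_abs _ _).trans ((Finset.sum_le_sum h1).trans ?_)
    rw [← Finset.sum_filter, Finset.sum_const, nsmul_eq_mul, mul_comm]
    gcongr
    exact_mod_cast card_filter_abs_add_lt_le K (y + s) N
  · refine Finset.sum_eq_zero fun k hk => ?_
    have hkS : k ∉ Finset.Icc (-(R + N : ℤ)) (R + N) := Finset.disjoint_left.1 hK hk
    rw [hN, mul_zero]
    rw [Finset.mem_Icc, not_and_or, not_le, not_le] at hkS
    have hy' := abs_lt.1 hy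
    rw [le_abs]
    rcases hkS with h | h
    · right
      have h' : k + 1 ≤ -(R + N : ℤ) := h
      have : (k : ℝ) + 1 ≤ -(R + N) := by exact_mod_cast h'
      linarith [hs.2]
    · left
      have : (R + N : ℝ) < k := by exact_mod_cast h
      linarith [hs.1]

end Tail

namespace IsAdmissibleWeight

variable {ρ : ℝ → ℝ} {p : ℝ≥0∞} [Fact (1 ≤ p)]

theorem isFiniteMeasure (h : IsAdmissibleWeight ρ) (hi : Integrable ρ volume) :
    IsFiniteMeasure (weightedMeasure ρ) := by
  refine ⟨?_⟩
  rw [weightedMeasure, withDensity_apply _ MeasurableSet.univ, setLIntegral_univ]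
  exact (hasFiniteIntegral_iff_ofReal (ae_of_all _ fun x => (h.pos x).le)).1 hi.2

theorem translate_toLp (h : IsAdmissibleWeight ρ) (hp : p ≠ ∞) (t : ℝ≥0) {f : ℝ → ℝ}
    (hf : MemLp f p (weightedMeasure ρ)) :
    h.translate hp t (hf.toLp f) = (h.memLp_translate t hf).toLp _ := by
  apply Lp.ext
  filter_upwards [h.translate_ae_eq hp t (hf.toLp f), h.ae_translate t hf.coeFn_toLp,
    (h.memLp_translate t hf).coeFn_toLp] with y h1 h2 h3
  rw [h1, h2, h3]

theorem translate_shiftLp (h : IsAdmissibleWeight ρ) (hp : p ≠ ∞)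
    [IsFiniteMeasure (weightedMeasure ρ)] (g : CompactlySupportedContinuousMap ℝ ℝ)
    (t : ℝ≥0) (s : ℝ) : h.translate hp t (shiftLp ρ p g s) = shiftLp ρ p g (s + t) := by
  rw [shiftLp, translate_toLp, shiftLp, MemLp.toLp_eq_toLp_iff]
  exact ae_of_all _ fun y => congrArg g (by ring)

/-- The dense set consists of the translates of compactly supported continuous functions, and `S_t`
translates backwards; each trajectory is half of a two-sided integrable one. -/
theorem frequentHypercyclicityCriterion (h : IsAdmissibleWeight ρ) (hp : p ≠ ∞)
    (hi : Integrable ρ volume) :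
    (h.translationSemigroup hp : C0Semigroup (WeightedLp p ρ)).FrequentHypercyclicityCriterion := by
  have := h.isFiniteMeasure hi
  set X₀ : Set (WeightedLp p ρ) := {f | ∃ g s, shiftLp ρ p g s = f} with hX₀
  -- A representation is fixed once per `f`, and every `S_t f` uses it; the identities compare
  -- values for the same `f`, so no consistency between choices is required.
  choose G s hGs using fun f : X₀ => f.2
  have hP : ∀ (f : X₀) (c : ℝ), PettisIntegrable (fun t => shiftLp ρ p (G f) (c + t)) volume :=
    fun f c => (pettisIntegrable_shiftLp hp (G f)).comp_equiv (MeasurableEquiv.addLeft c)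
      (measurePreserving_add_left volume c)
  have hT : ∀ (t : ℝ≥0) (g) (c : ℝ), (h.translationSemigroup hp).op t (shiftLp ρ p g c) =
      shiftLp ρ p g (c + t) := fun t g c => h.translate_shiftLp hp g t c
  refine ⟨X₀, fun t f => ⟨shiftLp ρ p (G f) (s f - t), _, _, rfl⟩, ?_, ?_, ?_, ?_, ?_⟩
  · intro f
    rw [Metric.mem_closure_iff]
    intro ε hε
    obtain ⟨g, hg⟩ := exists_shiftLp_near hp f hε
    exact ⟨_, ⟨g, 0, rfl⟩, by rwa [dist_eq_norm]⟩
  · intro f t _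
    simp only [hT, sub_add_cancel, hGs]
  · intro f t r _ htr
    simp only [hT]
    rw [NNReal.coe_sub htr.le]
    congr 1
    ring
  · intro f
    refine ((hP f (s f)).restrict measurableSet_Ici).congr_ae ?_
    filter_upwards [ae_restrict_mem measurableSet_Ici] with t ht
    conv_rhs => rw [← hGs f]
    rw [hT, Real.coe_toNNReal _ ht]
  · intro f
    have h1 := (hP f (s f)).comp_equiv (MeasurableEquiv.neg ℝ) (Measure.measurePreserving_neg volume)
    refine (h1.restrict measurableSet_Ici).congr_ae ?_
    filter_upwards [ae_restrict_mem measurableSet_Ici] with t ht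
    simp only [Real.coe_toNNReal _ (mem_Ici.1 ht), sub_eq_add_neg]
    rfl

end IsAdmissibleWeight

/-! ### Functions built from spaced copies of one bump. -/

section Blocks

/-- The sum of the translates `c q * g (y - P q)` over `q : ℤ`, for `g` supported in
`[-P/2, P/2]`. -/
noncomputable def blockFun (c : ℤ → ℝ) (g : ℝ → ℝ) (P : ℝ) (y : ℝ) : ℝ :=
  c (round (y / P)) * g (y - P * round (y / P))

variable {c : ℤ → ℝ} {g : ℝ → ℝ} {P B N : ℝ}

theorem measurable_blockFun (c : ℤ → ℝ) (hg : Measurable g) (P : ℝ) :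
    Measurable (blockFun c g P) := by
  have hr : Measurable fun y : ℝ => round (y / P) := by
    simp only [round_eq]
    exact Int.measurable_floor.comp ((measurable_id.div_const P).add_const _)
  have hr' : Measurable fun y : ℝ => ((round (y / P) : ℤ) : ℝ) := measurable_from_top.comp hr
  exact (measurable_from_top.comp hr).mul (hg.comp (measurable_id.sub (hr'.const_mul P)))

theorem abs_blockFun_le (hc : ∀ q, |c q| ≤ 1) (hB : ∀ y, |g y| ≤ B) (y : ℝ) :
    |blockFun c g P y| ≤ B := by
  rw [blockFun, abs_mul]
  exact (mul_le_of_le_one_left (abs_nonneg _) (hc _)).trans (hB _)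

theorem blockFun_add_mul (hP : 0 < P) (y : ℝ) (q : ℤ) :
    blockFun c g P (y + P * q) = blockFun (fun k => c (k + q)) g P y := by
  have h : (y + P * q) / P = y / P + q := by field_simp
  rw [blockFun, blockFun, h, round_add_intCast]
  congr 2
  push_cast
  ring

theorem blockFun_eq_self (hP : 0 < P) (hc : c 0 = 1) {y : ℝ} (hy : |y| < P / 2) :
    blockFun c g P y = g y := by
  have h : round (y / P) = 0 := by
    rw [round_eq_zero_iff, mem_Ico]
    have := abs_lt.1 hy
    constructor
    · rw [le_div_iff₀ hP]; linarith
    · rw [div_lt_iff₀ hP]; linarith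
  rw [blockFun, h, hc]
  simp

theorem exists_of_blockFun_ne_zero (hN : ∀ y, N ≤ |y| → g y = 0) {y : ℝ}
    (hy : blockFun c g P y ≠ 0) : ∃ q : ℤ, c q ≠ 0 ∧ |y - P * q| < N := by
  refine ⟨round (y / P), left_ne_zero_of_mul hy, ?_⟩
  by_contra h
  exact right_ne_zero_of_mul hy (hN _ (not_lt.1 h))

end Blocks

section BlockNorm

variable {ρ : ℝ → ℝ} {p : ℝ≥0∞} [IsFiniteMeasure (weightedMeasure ρ)]

theorem memLp_blockFun {c : ℤ → ℝ} (hc : ∀ q, |c q| ≤ 1)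
    (g : CompactlySupportedContinuousMap ℝ ℝ) (P : ℝ) :
    MemLp (blockFun c g P) p (weightedMeasure ρ) := by
  obtain ⟨B, N, -, hB, -⟩ := g.exists_bounds
  exact MemLp.of_bound (measurable_blockFun c g.continuous.measurable P).aestronglyMeasurable B
    (ae_of_all _ (abs_blockFun_le hc hB))

/-- For `|y| < P / 2` only the central copy is seen and the difference is zero; beyond that `g`
itself vanishes and only the other copies remain. -/
theorem norm_toLp_sub_shiftLp_le [Fact (1 ≤ p)] {c : ℤ → ℝ} (hc : ∀ q, |c q| ≤ 1) (hc0 : c 0 = 1)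
    {g : CompactlySupportedContinuousMap ℝ ℝ} {P B N : ℝ} (hP : 0 < P) (hB0 : 0 ≤ B)
    (hB : ∀ y, |g y| ≤ B) (hN : ∀ y, N ≤ |y| → g y = 0) (hNP : 2 * N ≤ P) {f : ℝ → ℝ}
    (hf : MemLp f p (weightedMeasure ρ)) (hfe : f = blockFun c g P) :
    ‖hf.toLp f - shiftLp ρ p g 0‖ ≤ B * tailNorm ρ p (P / 2) := by
  rw [shiftLp, ← MemLp.toLp_sub]
  subst hfe
  refine norm_toLp_le_tailNorm _ hB0 (fun y => ?_) fun y hy => ?_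
  · simp only [Pi.sub_apply, add_zero]
    rcases lt_or_ge |y| (P / 2) with hy | hy
    · rw [blockFun_eq_self hP hc0 hy, sub_self, abs_zero]
      exact hB0
    · rw [hN y (by linarith), sub_zero]
      exact abs_blockFun_le hc hB y
  · simp only [Pi.sub_apply, add_zero]
    rw [blockFun_eq_self hP hc0 hy, sub_self]

end BlockNorm

/-! ### Separated visit times of positive density. -/

section VisitTimes

/-- The period of the `l`-th level in the construction of visit times. -/
def levelPeriod (N : ℕ → ℕ) (l : ℕ) : ℕ := ∏ j ∈ Finset.range (l + 1), (32 * 2 ^ j * N j)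

/-- The indices `q ≥ 1` such that `levelPeriod N l * q` is far from the multiples of the periods
of all higher levels. -/
def levelIndices (N : ℕ → ℕ) (l : ℕ) : Set ℤ :=
  {q | 1 ≤ q ∧ ∀ l' > l, ∀ q' : ℤ, 1 ≤ q' →
    2 * (N l' : ℤ) ≤ |levelPeriod N l * q - levelPeriod N l' * q'|}

variable {N : ℕ → ℕ}

theorem levelPeriod_pos (hN : ∀ l, 1 ≤ N l) (l : ℕ) : 0 < levelPeriod N l :=
  Finset.prod_pos fun j _ => by have := hN j; positivity

theorem two_mul_le_levelPeriod (hN : ∀ l, 1 ≤ N l) (l : ℕ) : 2 * N l ≤ levelPeriod N l := by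
  have h1 : 32 * 2 ^ l * N l ≤ levelPeriod N l :=
    Nat.le_of_dvd (levelPeriod_pos hN l)
      (Finset.dvd_prod_of_mem (fun j => 32 * 2 ^ j * N j) (Finset.self_mem_range_succ l))
  have h2 : 1 ≤ 2 ^ l := Nat.one_le_two_pow
  nlinarith

theorem exists_levelPeriod_eq_mul (hN : ∀ l, 1 ≤ N l) {l l' : ℕ} (h : l < l') :
    ∃ R : ℕ, levelPeriod N l' = levelPeriod N l * R ∧ 32 * 2 ^ l' * N l' ≤ R := by
  refine ⟨∏ j ∈ Finset.Ico (l + 1) (l' + 1), (32 * 2 ^ j * N j),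
    (Finset.prod_range_mul_prod_Ico _ (by omega)).symm, ?_⟩
  refine Nat.le_of_dvd (Finset.prod_pos fun j _ => by have := hN j; positivity) ?_
  exact Finset.dvd_prod_of_mem (fun j => 32 * 2 ^ j * N j) (Finset.mem_Ico.2 ⟨h, by omega⟩)

-- Since `q' ≥ 1` and `2M ≤ R / 2`, a multiple close to some `q ≤ K` satisfies `R q' ≤ 2K`. Each of
-- these at most `2K / R` multiples spoils at most `4M` integers. Excluding `q' = 0` is what avoids
-- an additive error for small `K`.
open Classical in
theorem card_near_multiples_le {R M : ℕ} (hM : 1 ≤ M) (hR : 4 * M ≤ R) (K : ℕ) :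
    (((Finset.Icc (1 : ℤ) K).filter fun q =>
      ∃ q' : ℤ, 1 ≤ q' ∧ |q - R * q'| < 2 * M).card : ℝ) ≤ 8 * M * K / R := by
  have hR0 : (0 : ℤ) < R := by have : 0 < R := by omega
                               exact_mod_cast this
  have hsub : ((Finset.Icc (1 : ℤ) K).filter fun q => ∃ q' : ℤ, 1 ≤ q' ∧ |q - R * q'| < 2 * M) ⊆
      (Finset.Icc (1 : ℤ) (2 * K / R)).biUnion fun q' =>
        Finset.Ioo (R * q' - 2 * M : ℤ) (R * q' + 2 * M) := by
    intro q hq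
    obtain ⟨hqK, q', hq', habs⟩ := Finset.mem_filter.1 hq
    have hqK' := Finset.mem_Icc.1 hqK
    have h1 := abs_lt.1 habs
    refine Finset.mem_biUnion.2 ⟨q', Finset.mem_Icc.2 ⟨hq', ?_⟩, Finset.mem_Ioo.2 ⟨?_, ?_⟩⟩
    · rw [Int.le_ediv_iff_mul_le hR0]
      have h2 : (4 * M : ℤ) ≤ R := by exact_mod_cast hR
      nlinarith
    · linarith
    · linarith
  have h1 := (Finset.card_le_card hsub).trans Finset.card_biUnion_le
  have h2 : ∀ q' ∈ Finset.Icc (1 : ℤ) (2 * K / R),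
      (Finset.Ioo (R * q' - 2 * M : ℤ) (R * q' + 2 * M)).card ≤ 4 * M := fun q' _ => by
    rw [Int.card_Ioo]
    omega
  have h3 := h1.trans (Finset.sum_le_card_nsmul _ _ _ h2)
  rw [Int.card_Icc, smul_eq_mul, add_sub_cancel_right] at h3
  have h4 : ((2 * K / R : ℤ).toNat : ℝ) ≤ 2 * K / R := by
    have h5 : ((2 * K / R : ℤ).toNat : ℤ) = 2 * K / R := Int.toNat_of_nonneg (by positivity)
    have h6 : ((2 * K / R : ℤ).toNat : ℤ) * R ≤ 2 * K := by
      rw [h5]; exact Int.ediv_mul_le _ hR0.ne'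
    rw [le_div_iff₀ (by exact_mod_cast hR0)]
    exact_mod_cast h6
  have h7 : (((Finset.Icc (1 : ℤ) K).filter fun q =>
      ∃ q' : ℤ, 1 ≤ q' ∧ |q - R * q'| < 2 * M).card : ℝ) ≤ (2 * K / R : ℤ).toNat * (4 * M) := by
    exact_mod_cast h3
  refine h7.trans ((mul_le_mul_of_nonneg_right h4 (by positivity)).trans (le_of_eq ?_))
  ring

-- A conflict with a higher level `l'` puts `q` within `2 N l'` of a multiple of the ratio `R l'` of
-- the periods, as dividing by the lower period only shrinks distances. Since `R l' ≥ 32 * 2 ^ l' *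
-- N l'`, this removes at most `K / 4 * 2⁻ˡ'` indices, and the losses sum to at most `K / 2`. Only
-- levels `l' ≤ K` can interfere.
open Classical in
theorem half_le_card_levelIndices (hN : ∀ l, 1 ≤ N l) (l K : ℕ) :
    (K : ℝ) / 2 ≤ (((Finset.Icc (1 : ℤ) K).filter (· ∈ levelIndices N l)).card : ℝ) := by
  choose! R hR hR' using fun l' (h : l < l') => exists_levelPeriod_eq_mul hN h
  have hcompl := Finset.card_filter_add_card_filter_not (s := Finset.Icc (1 : ℤ) K)
    (· ∈ levelIndices N l)
  rw [Int.card_Icc] at hcompl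
  have hsub : ((Finset.Icc (1 : ℤ) K).filter fun q => ¬ q ∈ levelIndices N l) ⊆
      (Finset.Ioc l K).biUnion fun l' => (Finset.Icc (1 : ℤ) K).filter fun q =>
        ∃ q' : ℤ, 1 ≤ q' ∧ |q - R l' * q'| < 2 * N l' := by
    intro q hq
    obtain ⟨hqK, hql⟩ := Finset.mem_filter.1 hq
    have hqK' := Finset.mem_Icc.1 hqK
    simp only [levelIndices, mem_ofPred_eq, not_and, not_forall, not_le] at hql
    obtain ⟨l', hl', q', hq', hlt⟩ := hql hqK'.1
    have hP1 : (1 : ℤ) ≤ levelPeriod N l := by exact_mod_cast levelPeriod_pos hN l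
    have habs : |q - R l' * q'| < 2 * N l' := by
      rw [hR l' hl'] at hlt
      have h1 : (levelPeriod N l : ℤ) * q - (levelPeriod N l * R l' : ℕ) * q' =
        levelPeriod N l * (q - R l' * q') := by push_cast; ring
      rw [h1, abs_mul, abs_of_nonneg (by linarith)] at hlt
      have := abs_nonneg (q - R l' * q')
      nlinarith
    refine Finset.mem_biUnion.2 ⟨l', Finset.mem_Ioc.2 ⟨hl', ?_⟩,
      Finset.mem_filter.2 ⟨hqK, q', hq', habs⟩⟩
    have h1 := (abs_lt.1 habs).1
    have h2 : (32 * 2 ^ l' * N l' : ℤ) ≤ R l' := by exact_mod_cast hR' l' hl'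
    have h3 : (l' : ℤ) < 2 ^ l' := by exact_mod_cast Nat.lt_two_pow_self (n := l')
    have h4 : (1 : ℤ) ≤ N l' := by exact_mod_cast hN l'
    have h5 : (R l' : ℤ) ≤ R l' * q' := le_mul_of_one_le_right (by positivity) hq'
    have h6 : (2 : ℤ) ^ l' ≤ 2 ^ l' * N l' := le_mul_of_one_le_right (by positivity) h4
    have h7 : (N l' : ℤ) ≤ 2 ^ l' * N l' := le_mul_of_one_le_left (by positivity) (by linarith)
    have : (l' : ℤ) ≤ K := by nlinarith
    exact_mod_cast this
  have hbad : (((Finset.Icc (1 : ℤ) K).filter fun q => ¬ q ∈ levelIndices N l).card : ℝ) ≤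
      K / 2 := by
    calc (((Finset.Icc (1 : ℤ) K).filter fun q => ¬ q ∈ levelIndices N l).card : ℝ)
        ≤ ∑ l' ∈ Finset.Ioc l K, (((Finset.Icc (1 : ℤ) K).filter fun q =>
            ∃ q' : ℤ, 1 ≤ q' ∧ |q - R l' * q'| < 2 * N l').card : ℝ) := by
          exact_mod_cast (Finset.card_le_card hsub).trans Finset.card_biUnion_le
      _ ≤ ∑ l' ∈ Finset.Ioc l K, (K / 4 : ℝ) * (1 / 2) ^ l' := by
          refine Finset.sum_le_sum fun l' hl' => ?_
          have hRl := hR' l' (Finset.mem_Ioc.1 hl').1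
          have h2 : 1 ≤ 2 ^ l' := Nat.one_le_two_pow
          have hNl := hN l'
          refine (card_near_multiples_le hNl (le_trans (by nlinarith) hRl) K).trans ?_
          have hR0 : (0 : ℝ) < R l' := by
            have : 0 < R l' := lt_of_lt_of_le (by positivity) hRl
            exact_mod_cast this
          have hRl' : (32 * 2 ^ l' * N l' : ℝ) ≤ R l' := by exact_mod_cast hRl
          rw [div_le_iff₀ hR0, one_div, inv_pow]
          calc (8 * N l' * K : ℝ) = K / 4 * (2 ^ l')⁻¹ * (32 * 2 ^ l' * N l') := by
                field_simp; ring
            _ ≤ _ := by gcongr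
      _ ≤ ∑ l' ∈ Finset.range (K + 1), (K / 4 : ℝ) * (1 / 2) ^ l' := by
          refine Finset.sum_le_sum_of_subset_of_nonneg (fun j hj => ?_) fun _ _ _ => by positivity
          have := Finset.mem_Ioc.1 hj
          exact Finset.mem_range.2 (by omega)
      _ ≤ K / 4 * 2 := by
          rw [← Finset.mul_sum]
          gcongr
          exact sum_geometric_two_le (K + 1)
      _ = K / 2 := by ring
  have h1 : (((Finset.Icc (1 : ℤ) K).filter (· ∈ levelIndices N l)).card : ℝ) +
      (((Finset.Icc (1 : ℤ) K).filter fun q => ¬ q ∈ levelIndices N l).card : ℝ) = K := by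
    have h2 : ((K : ℤ) + 1 - 1).toNat = K := by omega
    rw [h2] at hcompl
    exact_mod_cast hcompl
  linarith

theorem two_mul_le_abs_sub_of_mem_levelIndices {l l' : ℕ} (hne : l ≠ l')
    {q q' : ℤ} (hq : q ∈ levelIndices N l) (hq' : q' ∈ levelIndices N l') :
    2 * (N (max l l') : ℤ) ≤ |levelPeriod N l * q - levelPeriod N l' * q'| := by
  rcases hne.lt_or_gt with h | h
  · rw [max_eq_right h.le]
    exact hq.2 l' h q' hq'.1
  · rw [max_eq_left h.le, abs_sub_comm]
    exact hq'.2 l h q hq.1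

-- At least half of the multiples of `P` begin an interval of length `δ` inside `S`, and these are
-- disjoint because `δ ≤ 1 ≤ P`.
open Classical in
theorem lowerDensity_pos_of_subset {S : Set ℝ} {Q : Set ℤ} {P δ : ℝ} (hP : 1 ≤ P) (hδ : 0 < δ)
    (hδ1 : δ ≤ 1)
    (hQ : ∀ K : ℕ, (K : ℝ) / 2 ≤ (((Finset.Icc (1 : ℤ) K).filter (· ∈ Q)).card : ℝ))
    (hS : ∀ q ∈ Q, 1 ≤ q → Ico (P * q) (P * q + δ) ⊆ S) : 0 < lowerDensity S := by
  have hP0 : 0 < P := by linarith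
  refine lt_of_lt_of_le (b := ENNReal.ofReal (δ / (4 * P))) (by simp; positivity) ?_
  refine le_liminf_of_le (by isBoundedDefault) ?_
  filter_upwards [eventually_ge_atTop (4 * P)] with T hT
  have hT0 : 0 < T := by linarith
  rw [ENNReal.le_div_iff_mul_le (Or.inl (by simpa using hT0)) (Or.inl ENNReal.ofReal_ne_top),
    ← ENNReal.ofReal_mul (by positivity)]
  have hfl := Nat.floor_le (show 0 ≤ T / P by positivity)
  have hfl' := Nat.lt_floor_add_one (T / P)
  have hfl4 : 4 ≤ T / P := by rw [le_div_iff₀ hP0]; linarith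
  -- Dropping the last multiple keeps its interval inside `[0, T]`. Since `T / P ≥ 4`, still `K ≥ T
  -- / (2P)`, which gives the density `δ / (4P)`.
  set K := ⌊T / P⌋₊ - 1 with hK
  have hK1 : ((K : ℕ) : ℝ) = ⌊T / P⌋₊ - 1 := by
    have : 1 ≤ ⌊T / P⌋₊ := Nat.le_floor (by norm_num; linarith)
    rw [hK, Nat.cast_sub this, Nat.cast_one]
  set G := (Finset.Icc (1 : ℤ) K).filter (· ∈ Q) with hG
  have hsub : (⋃ q ∈ G, Ico (P * (q : ℝ)) (P * q + δ)) ⊆ S ∩ Icc 0 T := by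
    refine iUnion₂_subset fun q hq => ?_
    obtain ⟨hqK, hqQ⟩ := Finset.mem_filter.1 hq
    have hqK' := Finset.mem_Icc.1 hqK
    refine subset_inter (hS q hqQ hqK'.1) fun t ht => ⟨?_, ?_⟩
    · have : (1 : ℝ) ≤ q := by exact_mod_cast hqK'.1
      exact le_trans (by positivity) ht.1
    · have h1 : (q : ℝ) ≤ K := by exact_mod_cast hqK'.2
      have h2 : P * q ≤ P * K := by gcongr
      have h3 : P * (K + 1) ≤ T := by
        rw [hK1, sub_add_cancel, ← le_div_iff₀' hP0]
        exact hfl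
      linarith [ht.2]
  refine le_trans ?_ (measure_mono hsub)
  rw [measure_biUnion_finset]
  · simp only [Real.volume_Ico, add_sub_cancel_left, Finset.sum_const, nsmul_eq_mul]
    rw [← ENNReal.ofReal_natCast, ← ENNReal.ofReal_mul (by positivity)]
    apply ENNReal.ofReal_le_ofReal
    have h1 := hQ K
    have h2 : T / P / 2 ≤ K := by rw [hK1]; linarith
    calc δ / (4 * P) * T = T / P / 2 / 2 * δ := by field_simp; norm_num
      _ ≤ G.card * δ := by gcongr; linarith
  · intro i _ j _ hij
    refine Set.disjoint_left.2 fun y hy hy' => hij ?_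
    have h1 : P * (i : ℝ) < P * (j + 1) := by linarith [hy.1, hy'.2]
    have h2 : P * (j : ℝ) < P * (i + 1) := by linarith [hy.2, hy'.1]
    have h1' := lt_of_mul_lt_mul_left h1 hP0.le
    have h2' := lt_of_mul_lt_mul_left h2 hP0.le
    have h1'' : i < j + 1 := by exact_mod_cast h1'
    have h2'' : j < i + 1 := by exact_mod_cast h2'
    omega
  · exact fun _ _ => measurableSet_Ico

end VisitTimes

/-- If `f n R → 0` as `R → ∞` for each `n`, there is an increasing sequence along which the
`f n` are as small as desired. -/
theorem exists_monotone_seq_of_tendsto {f : ℕ → ℝ → ℝ}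
    (hf : ∀ n, Tendsto (f n) atTop (𝓝 0)) {ε : ℕ → ℝ} (hε : ∀ n, 0 < ε n) (r : ℕ → ℕ) :
    ∃ N : ℕ → ℕ, Monotone N ∧ (∀ n, 1 ≤ N n) ∧ (∀ n, r n ≤ N n) ∧ ∀ n, f n (N n) ≤ ε n := by
  have h : ∀ n, ∃ M : ℕ, ∀ k ≥ M, f n k ≤ ε n := fun n =>
    eventually_atTop.1
      (((hf n).comp tendsto_natCast_atTop_atTop).eventually_le_const (hε n))
  choose M hM using h
  have hle : ∀ n, M n + r n + 1 ≤ ∑ j ∈ Finset.range (n + 1), (M j + r j + 1) := fun n =>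
    Finset.single_le_sum (f := fun j => M j + r j + 1) (fun _ _ => Nat.zero_le _)
      (Finset.self_mem_range_succ n)
  refine ⟨fun n => ∑ j ∈ Finset.range (n + 1), (M j + r j + 1), ?_, fun n => ?_, fun n => ?_,
    fun n => hM n _ ?_⟩
  · intro a b hab
    exact Finset.sum_le_sum_of_subset (Finset.range_mono (by omega))
  · have := hle n; dsimp only; omega
  · have := hle n; dsimp only; omega
  · have := hle n; dsimp only; omega

/-! ### The frequently hypercyclic vector and the density of periodic points. -/

namespace IsAdmissibleWeight

variable {ρ : ℝ → ℝ} {p : ℝ≥0∞} [Fact (1 ≤ p)]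

theorem exists_norm_translate_le (h : IsAdmissibleWeight ρ) (hp : p ≠ ∞) :
    ∃ C : ℝ, 0 < C ∧ ∀ s : ℝ≥0, s ≤ 1 → ∀ f : WeightedLp p ρ, ‖h.translate hp s f‖ ≤ C * ‖f‖ := by
  obtain ⟨M, ω, hC⟩ := h.exists_eLpNorm_translate_le hp
  set D : ℝ≥0∞ := ENNReal.ofReal (|M| * Real.exp |ω|) ^ (1 / p).toReal with hD
  have hDt : D ≠ ∞ := ENNReal.rpow_ne_top_of_nonneg ENNReal.toReal_nonneg ENNReal.ofReal_ne_top
  have hD0 : 0 ≤ D.toReal := ENNReal.toReal_nonneg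
  refine ⟨D.toReal + 1, by positivity, fun s hs f => ?_⟩
  have hs' : (s : ℝ) ≤ 1 := hs
  have h1 : eLpNorm (h.translate hp s f) p (weightedMeasure ρ) ≤
      D * eLpNorm f p (weightedMeasure ρ) := by
    rw [eLpNorm_congr_ae (h.translate_ae_eq hp s f)]
    refine (hC s f (Lp.memLp f)).trans ?_
    refine mul_le_mul_left (ENNReal.rpow_le_rpow (ENNReal.ofReal_le_ofReal ?_)
      ENNReal.toReal_nonneg) _
    refine mul_le_mul (le_abs_self M) (Real.exp_le_exp.2 ?_) (Real.exp_pos _).le (abs_nonneg M)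
    calc ω * s ≤ |ω| * 1 := mul_le_mul (le_abs_self ω) hs' s.2 (abs_nonneg ω)
      _ = |ω| := mul_one _
  rw [Lp.norm_def, Lp.norm_def]
  refine (ENNReal.toReal_mono (ENNReal.mul_ne_top hDt (Lp.eLpNorm_ne_top f)) h1).trans ?_
  rw [ENNReal.toReal_mul]
  gcongr
  linarith

/-- A vector whose orbit approximates the `l`-th of a given sequence of test functions up to
`2 * 2⁻ˡ` at a set of times of positive lower density. -/
theorem exists_approximating_orbit (h : IsAdmissibleWeight ρ) (hp : p ≠ ∞)
    [IsFiniteMeasure (weightedMeasure ρ)] (g : ℕ → CompactlySupportedContinuousMap ℝ ℝ) :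
    ∃ (x : WeightedLp p ρ) (N : ℕ → ℕ), (∀ l, 1 ≤ N l) ∧
      ∀ l, ∀ q ∈ levelIndices N l, ∀ t : ℝ≥0, (t : ℝ) = levelPeriod N l * q →
        ‖h.translate hp t x - shiftLp ρ p (g l) 0‖ ≤ 2 * (1 / 2) ^ l := by
  classical
  choose B r hB0 hB hr using fun l => (g l).exists_bounds
  -- `B' m` dominates the bounds of all levels up to `m`, so one choice of `N m` makes the tail
  -- beyond `N m` small for each of those levels.
  set B' : ℕ → ℝ := fun l => ∑ j ∈ Finset.range (l + 1), B j with hB'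
  have hBB' : ∀ {l l' : ℕ}, l ≤ l' → B l ≤ B' l' := fun {l l'} hl =>
    Finset.single_le_sum (f := B) (fun j _ => hB0 j) (Finset.mem_range.2 (by omega))
  obtain ⟨N, hNm, hN1, hNr, hNε⟩ := exists_monotone_seq_of_tendsto
    (f := fun l R => B' l * tailNorm ρ p R)
    (fun l => by simpa using (tendsto_tailNorm hp).const_mul (B' l))
    (ε := fun l => (1 / 4) ^ l) (fun l => by positivity) r
  have hgN : ∀ l y, (N l : ℝ) ≤ |y| → g l y = 0 := fun l y hy => by
    refine hr l y (le_trans ?_ hy)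
    exact_mod_cast hNr l
  have hP0 : ∀ l, (0 : ℝ) < levelPeriod N l := fun l => by exact_mod_cast levelPeriod_pos hN1 l
  have hP2 : ∀ l, 2 * (N l : ℝ) ≤ levelPeriod N l := fun l => by
    exact_mod_cast two_mul_le_levelPeriod hN1 l
  have htail : ∀ {l m : ℕ} {R : ℝ}, l ≤ m → (N m : ℝ) ≤ R →
      B l * tailNorm ρ p R ≤ (1 / 4) ^ m := fun {l m R} hlm hR => by
    refine le_trans ?_ (hNε m)
    exact mul_le_mul (hBB' hlm) (tailNorm_antitone hR) (tailNorm_nonneg _ _ _)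
      ((hB0 l).trans (hBB' hlm))
  set c : ℕ → ℤ → ℝ := fun l => (levelIndices N l).indicator fun _ => 1 with hc
  have hc1 : ∀ l q, |c l q| ≤ 1 := fun l q => by
    by_cases hq : q ∈ levelIndices N l <;> simp [hc, hq]
  have hcmem : ∀ {l q}, c l q ≠ 0 → q ∈ levelIndices N l := fun {l q} hq =>
    mem_of_indicator_ne_zero hq
  set F : ℕ → ℝ → ℝ := fun l => blockFun (c l) (g l) (levelPeriod N l) with hF
  have hFm : ∀ l, MemLp (F l) p (weightedMeasure ρ) := fun l => memLp_blockFun (hc1 l) (g l) _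
  have hsum : Summable fun l => (hFm l).toLp (F l) := by
    refine Summable.of_norm_bounded (g := fun l : ℕ => (1 / 4 : ℝ) ^ l)
      (summable_geometric_of_lt_one (by norm_num) (by norm_num)) fun l => ?_
    refine (norm_toLp_le_tailNorm (hFm l) (R := N l) (hB0 l)
      (abs_blockFun_le (hc1 l) (hB l)) fun y hy => ?_).trans (htail le_rfl le_rfl)
    by_contra hne
    obtain ⟨q, hq, hyq⟩ := exists_of_blockFun_ne_zero (hgN l) hne
    have hq1 : (1 : ℝ) ≤ q := by exact_mod_cast (hcmem hq).1
    have h1 : (levelPeriod N l : ℝ) ≤ levelPeriod N l * q :=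
      le_mul_of_one_le_right (hP0 l).le hq1
    have h2 := (abs_lt.1 hyq).1
    have h3 := (abs_lt.1 hy).2
    have h4 := hP2 l
    linarith
  refine ⟨∑' l, (hFm l).toLp (F l), N, hN1, fun l q hq t ht => ?_⟩
  -- At this time level `l` shows `g l` at the origin. The centres of every other level `l'` are at
  -- distance at least `2 * N (max l l')`, so that level vanishes on `|y| < N (max l l')`. Both
  -- errors are at most `4 ^ (-max l l')`, which is at most `2⁻ˡ * 2⁻ˡ'` and sums over `l'` to `2 *
  -- 2⁻ˡ`.
  have hterm : ∀ l', ‖h.translate hp t ((hFm l').toLp (F l')) -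
      (if l' = l then shiftLp ρ p (g l) 0 else 0)‖ ≤ (1 / 2) ^ l * (1 / 2) ^ l' := by
    intro l'
    have hmax : ((1 : ℝ) / 4) ^ (max l l') ≤ (1 / 2) ^ l * (1 / 2) ^ l' := by
      have h1 : ((1 : ℝ) / 4) = 1 / 2 * (1 / 2) := by norm_num
      rw [h1, mul_pow]
      have h2 : ((1 : ℝ) / 2) ^ max l l' ≤ (1 / 2) ^ l :=
        pow_le_pow_of_le_one (by norm_num) (by norm_num) (le_max_left _ _)
      have h3 : ((1 : ℝ) / 2) ^ max l l' ≤ (1 / 2) ^ l' :=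
        pow_le_pow_of_le_one (by norm_num) (by norm_num) (le_max_right _ _)
      gcongr
    refine le_trans ?_ hmax
    rw [h.translate_toLp]
    by_cases hl : l' = l
    · subst hl
      rw [if_pos rfl, max_self]
      refine (norm_toLp_sub_shiftLp_le (c := fun k => c l' (k + q)) (fun k => hc1 l' _) ?_ (hP0 l')
        (hB0 l') (hB l') (hgN l') (hP2 l') _ ?_).trans (htail le_rfl ?_)
      · simp [hc, hq]
      · ext y
        rw [ht]
        exact blockFun_add_mul (hP0 l') y q
      · linarith [hP2 l']
    · rw [if_neg hl, sub_zero]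
      refine (norm_toLp_le_tailNorm _ (R := N (max l l')) (hB0 l')
        (fun y => abs_blockFun_le (hc1 l') (hB l') _) fun y hy => ?_).trans
        (htail (le_max_right _ _) le_rfl)
      by_contra hne
      obtain ⟨q', hq', hyq⟩ := exists_of_blockFun_ne_zero (hgN l') hne
      have h1 := two_mul_le_abs_sub_of_mem_levelIndices (Ne.symm hl) hq (hcmem hq')
      have h2 : 2 * (N (max l l') : ℝ) ≤
          |(levelPeriod N l : ℝ) * q - levelPeriod N l' * q'| := by exact_mod_cast h1
      have h3 : (N l' : ℝ) ≤ N (max l l') := by exact_mod_cast hNm (le_max_right l l')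
      rw [ht] at hyq
      have h4 := abs_lt.1 hyq
      have h5 := abs_lt.1 hy
      rcases le_abs.1 h2 with h6 | h6 <;> linarith [h4.1, h4.2, h5.1, h5.2]
  have hgeo : HasSum (fun l' : ℕ => ((1 : ℝ) / 2) ^ l * (1 / 2) ^ l') ((1 / 2) ^ l * 2) :=
    hasSum_geometric_two.mul_left _
  have htrans : HasSum (fun l' => h.translate hp t ((hFm l').toLp (F l')) -
      (if l' = l then shiftLp ρ p (g l) 0 else 0))
      (h.translate hp t (∑' l, (hFm l).toLp (F l)) - shiftLp ρ p (g l) 0) :=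
    ((h.translate hp t).hasSum hsum.hasSum).sub (hasSum_ite_eq l _)
  rw [← htrans.tsum_eq, mul_comm]
  exact tsum_of_norm_bounded hgeo hterm

theorem frequentlyHypercyclic (h : IsAdmissibleWeight ρ) (hp : p ≠ ∞)
    (hi : Integrable ρ volume) :
    (h.translationSemigroup hp : C0Semigroup (WeightedLp p ρ)).FrequentlyHypercyclic := by
  have := h.isFiniteMeasure hi
  have : Fact (p ≠ ∞) := ⟨hp⟩
  -- Pairing makes each dense point the target of infinitely many levels, so it is approached with
  -- arbitrarily small error `2⁻ˡ`.
  have hnear : ∀ l : ℕ, ∃ g : CompactlySupportedContinuousMap ℝ ℝ,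
      ‖TopologicalSpace.denseSeq (WeightedLp p ρ) l.unpair.1 - shiftLp ρ p g 0‖ < (1 / 2) ^ l :=
    fun l => exists_shiftLp_near hp _ (by positivity)
  choose g hg using hnear
  obtain ⟨x, N, hN1, hx⟩ := h.exists_approximating_orbit hp g
  refine ⟨x, fun U hU hUne => ?_⟩
  obtain ⟨z, hz⟩ := hUne
  obtain ⟨ε, hε, hball⟩ := Metric.isOpen_iff.1 hU z hz
  obtain ⟨C, hC0, hC⟩ := h.exists_norm_translate_le hp
  obtain ⟨n, hn⟩ : ∃ n, dist z (TopologicalSpace.denseSeq (WeightedLp p ρ) n) < ε / 4 :=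
    (TopologicalSpace.denseRange_denseSeq (WeightedLp p ρ)).exists_dist_lt z (by positivity)
  -- The term `2 * C` comes from moving the orbit error `2 * 2⁻ˡ` forward by a time at most one, and
  -- the `1` from approximating the dense point by `g l`.
  have hlim : Tendsto (fun k : ℕ => (2 * C + 1) * (1 / 2 : ℝ) ^ k) atTop (𝓝 0) := by
    simpa using (tendsto_pow_atTop_nhds_zero_of_lt_one (r := (1 / 2 : ℝ)) (by norm_num)
      (by norm_num)).const_mul (2 * C + 1)
  obtain ⟨k, hk⟩ := (hlim.eventually_lt_const (show 0 < ε / 4 by positivity)).exists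
  set l := Nat.pair n k with hl
  have hkl : ((1 : ℝ) / 2) ^ l ≤ (1 / 2) ^ k :=
    pow_le_pow_of_le_one (by norm_num) (by norm_num) (Nat.right_le_pair n k)
  have hl4 : (2 * C + 1) * ((1 : ℝ) / 2) ^ l < ε / 4 :=
    lt_of_le_of_lt (by gcongr) hk
  set γ := shiftLp ρ p (g l) 0 with hγ
  have hgl : ‖TopologicalSpace.denseSeq (WeightedLp p ρ) n - γ‖ < (1 / 2) ^ l := by
    have := hg l
    rwa [hl, Nat.unpair_pair, ← hl] at this
  have hcont : Tendsto (fun s : ℝ => h.translate hp s.toNNReal γ) (𝓝 0) (𝓝 γ) := by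
    have h2 : Tendsto Real.toNNReal (𝓝 0) (𝓝 0) := by
      simpa using continuous_real_toNNReal.tendsto 0
    exact (h.tendsto_translate hp γ).comp h2
  obtain ⟨δ, hδ, hδγ⟩ := Metric.tendsto_nhds_nhds.1 hcont (ε / 4) (by positivity)
  refine lowerDensity_pos_of_subset (Q := levelIndices N l) (P := levelPeriod N l)
    (δ := min δ 1) (by exact_mod_cast levelPeriod_pos hN1 l) (by positivity) (min_le_right _ _)
    (half_le_card_levelIndices hN1 l) fun q hq hq1 t ht => ?_
  have hq0 : (0 : ℝ) ≤ levelPeriod N l * q := by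
    have : (0 : ℝ) ≤ q := by exact_mod_cast zero_le_one.trans hq1
    positivity
  have ht0 : 0 ≤ t := hq0.trans ht.1
  refine ⟨ht0, hball ?_⟩
  set s := t - levelPeriod N l * q with hs
  have hs0 : 0 ≤ s := sub_nonneg.2 ht.1
  have hsδ : s < min δ 1 := by rw [hs]; linarith [ht.2]
  have hop : (h.translationSemigroup hp).op t.toNNReal x =
      h.translate hp s.toNNReal (h.translate hp (levelPeriod N l * q : ℝ).toNNReal x) := by
    have : t.toNNReal = s.toNNReal + (levelPeriod N l * q : ℝ).toNNReal := by
      rw [← Real.toNNReal_add hs0 hq0, hs, sub_add_cancel]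
    rw [this, C0Semigroup.op_add]
    rfl
  rw [hop, Metric.mem_ball, dist_eq_norm]
  set w := h.translate hp (levelPeriod N l * q : ℝ).toNNReal x with hw
  have h1 : ‖w - γ‖ ≤ 2 * (1 / 2) ^ l := hx l q hq _ (Real.coe_toNNReal _ hq0)
  have h2 : ‖h.translate hp s.toNNReal (w - γ)‖ ≤ C * (2 * (1 / 2) ^ l) := by
    refine (hC _ ?_ _).trans (by gcongr)
    rw [Real.toNNReal_le_one]
    exact (hsδ.trans_le (min_le_right _ _)).le
  have h3 : ‖h.translate hp s.toNNReal γ - γ‖ < ε / 4 := by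
    rw [← dist_eq_norm]
    refine hδγ ?_
    rw [Real.dist_eq, sub_zero, abs_of_nonneg hs0]
    exact hsδ.trans_le (min_le_left _ _)
  rw [dist_eq_norm] at hn
  have e : h.translate hp s.toNNReal w - z = h.translate hp s.toNNReal (w - γ) +
      (h.translate hp s.toNNReal γ - γ) -
      (TopologicalSpace.denseSeq (WeightedLp p ρ) n - γ) -
      (z - TopologicalSpace.denseSeq (WeightedLp p ρ) n) := by
    rw [map_sub]; abel
  rw [e]
  have t1 := norm_sub_le (h.translate hp s.toNNReal (w - γ) +
      (h.translate hp s.toNNReal γ - γ) - (TopologicalSpace.denseSeq (WeightedLp p ρ) n - γ))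
      (z - TopologicalSpace.denseSeq (WeightedLp p ρ) n)
  have t2 := norm_sub_le (h.translate hp s.toNNReal (w - γ) +
      (h.translate hp s.toNNReal γ - γ)) (TopologicalSpace.denseSeq (WeightedLp p ρ) n - γ)
  have t3 := norm_add_le (h.translate hp s.toNNReal (w - γ)) (h.translate hp s.toNNReal γ - γ)
  linarith

/-- A bump supported well inside `(-R, R)` is repeated with period `2R`; the added copies lie
outside `(-R, R)` and cost at most `B * tailNorm ρ p R`. -/
theorem dense_isPeriodicPoint (h : IsAdmissibleWeight ρ) (hp : p ≠ ∞)
    (hi : Integrable ρ volume) :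
    Dense {f : WeightedLp p ρ | (h.translationSemigroup hp).IsPeriodicPoint f} := by
  have := h.isFiniteMeasure hi
  intro f
  rw [Metric.mem_closure_iff]
  intro ε hε
  obtain ⟨g, hg⟩ := exists_shiftLp_near hp f (half_pos hε)
  obtain ⟨B, N, hB0, hB, hN⟩ := g.exists_bounds
  have hlim : Tendsto (fun R : ℕ => B * tailNorm ρ p R) atTop (𝓝 0) := by
    simpa using ((tendsto_tailNorm hp).comp tendsto_natCast_atTop_atTop).const_mul B
  obtain ⟨R, hR, hRN⟩ := ((hlim.eventually_lt_const (half_pos hε)).and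
    (eventually_ge_atTop (N + 1))).exists
  have hRN' : (N + 1 : ℝ) ≤ R := by exact_mod_cast hRN
  have hR0 : (0 : ℝ) < 2 * R := by have : (0 : ℝ) ≤ N := Nat.cast_nonneg N; linarith
  have hc : ∀ q : ℤ, |(fun _ : ℤ => (1 : ℝ)) q| ≤ 1 := fun q => by simp
  have hm := memLp_blockFun (p := p) (ρ := ρ) hc g (2 * R : ℝ)
  refine ⟨hm.toLp _, ⟨2 * R, by exact_mod_cast hR0, ?_⟩, ?_⟩
  · refine (h.translate_toLp hp _ hm).trans ?_
    rw [MemLp.toLp_eq_toLp_iff]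
    refine ae_of_all _ fun y => ?_
    have := blockFun_add_mul (c := fun _ => 1) (g := g) hR0 y 1
    simpa using this
  · have h1 := norm_toLp_sub_shiftLp_le hc rfl hR0 hB0 hB hN (by linarith) hm rfl
    rw [mul_div_cancel_left₀ _ (two_ne_zero' ℝ)] at h1
    rw [dist_eq_norm]
    calc ‖f - hm.toLp _‖ = ‖(f - shiftLp ρ p g 0) - (hm.toLp _ - shiftLp ρ p g 0)‖ := by
          congr 1; abel
      _ ≤ _ := norm_sub_le _ _
      _ < ε := by linarith

end IsAdmissibleWeight

/-! ### Assembly of the equivalences. -/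

theorem C0Semigroup.FrequentlyHypercyclic.hypercyclic {X : Type*} [NormedAddCommGroup X]
    [NormedSpace ℝ X] {T : C0Semigroup X} (hT : T.FrequentlyHypercyclic) : T.Hypercyclic := by
  obtain ⟨x, hx⟩ := hT
  refine ⟨x, dense_iff_inter_open.2 fun U hU hne => ?_⟩
  by_contra hcon
  have hempty : {t : ℝ | 0 ≤ t ∧ T.op t.toNNReal x ∈ U} = ∅ :=
    eq_empty_of_forall_notMem fun t ht => hcon ⟨_, ht.2, _, rfl⟩
  have := hx U hU hne
  rw [hempty, lowerDensity] at this
  simp at this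

theorem C0Semigroup.exists_isPeriodicPoint_of_dense {X : Type*} [NormedAddCommGroup X]
    [NormedSpace ℝ X] [Nontrivial X] {T : C0Semigroup X}
    (hT : Dense {x : X | T.IsPeriodicPoint x}) : ∃ x ≠ 0, T.IsPeriodicPoint x := by
  obtain ⟨z, hz⟩ := exists_ne (0 : X)
  obtain ⟨y, hy, hy0⟩ := hT.exists_mem_open isOpen_ne ⟨z, hz⟩
  exact ⟨y, hy0, hy⟩

theorem mainTheorem2 (p : ℝ≥0∞) [Fact (1 ≤ p)] (hp : p ≠ ∞) (ρ : ℝ → ℝ)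
    (hρ : IsAdmissibleWeight ρ) :
    List.TFAE [
      (hρ.translationSemigroup hp : C0Semigroup (WeightedLp p ρ)).FrequentlyHypercyclic,
      Summable (fun k : ℤ => ρ k),
      Integrable ρ volume,
      (hρ.translationSemigroup hp : C0Semigroup (WeightedLp p ρ)).Chaotic,
      (hρ.translationSemigroup hp :
        C0Semigroup (WeightedLp p ρ)).FrequentHypercyclicityCriterion] := by
  have := hρ.nontrivial_weightedLp hp
  tfae_have 1 → 2 := hρ.summable_of_frequentlyHypercyclic hp
  tfae_have 2 ↔ 3 := by simpa using (hρ.integrable_iff_summable one_pos).symm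
  tfae_have 3 → 1 := hρ.frequentlyHypercyclic hp
  tfae_have 3 → 4 := fun hi =>
    ⟨(hρ.frequentlyHypercyclic hp hi).hypercyclic, hρ.dense_isPeriodicPoint hp hi⟩
  tfae_have 4 → 3 := fun hT => by
    obtain ⟨f, hf, hper⟩ := C0Semigroup.exists_isPeriodicPoint_of_dense hT.2
    exact hρ.integrable_of_isPeriodicPoint hp hf hper
  tfae_have 3 → 5 := hρ.frequentHypercyclicityCriterion hp
  tfae_have 5 → 3 := fun hT => by
    obtain ⟨f, hf, hper⟩ := hT.exists_isPeriodicPoint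
    exact hρ.integrable_of_isPeriodicPoint hp hf hper
  tfae_finish
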